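/- Let $p,q\ge 1$ be integers with $n=p+q\ge 3$, let $(\overline M^{\,p},\overline g)$ and $(\widetilde M^{\,q},\widetilde g)$ be smooth semi-Riemannian manifolds, and let $f$ be a positive smooth function on $\overline M$. Let $M=\overline M\times_f\widetilde M$ be the warped product, that is, $\overline M\times\widetilde M$ with the metric $g=\pi^*\overline g+(f\circ\pi)\,\sigma^*\widetilde g$, where $\pi,\sigma$ are the projections onto $\overline M$ and $\widetilde M$. Write $R,S,\kappa$ for the Riemann-Christoffel curvature tensor, the Ricci tensor and the scalar curvature of $g$, and mark with a bar or a tilde the corresponding quantities of $\overline g$ and $\widetilde g$. The conventions are $R_{hijk}=g_{hl}(\partial_k\Gamma^l_{ij}-\partial_j\Gamma^l_{ik}+\Gamma^m_{ij}\Gamma^l_{mk}-\Gamma^m_{ik}\Gamma^l_{mj})$, $S_{jk}=g^{il}R_{ijkl}$, $\kappa=g^{jk}S_{jk}$, and $(A\wedge E)_{ijkl}=A_{il}E_{jk}+A_{jk}E_{il}-A_{ik}E_{jl}-A_{jl}E_{ik}$ for symmetric $(0,2)$-tensors $A,E$. On the base, with $f_a=\partial_a f$, put $$T_{ab}=\frac1{2f}\Big(\overline\nabla_b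 f_a-\frac1{2f}f_af_b\Big),\qquad P=\frac1{4f^2}\,\overline g^{ab}f_af_b,\qquad Q=-f\big((q-1)P+\overline g^{ab}T_{ab}\big).$$ Call $M$ conformally flat if its conformal curvature tensor $C=R-\frac1{n-2}\,g\wedge S+\frac{\kappa}{2(n-1)(n-2)}\,g\wedge g$ vanishes identically. Suppose that $M$ is non-flat (that is, $R$ does not vanish identically). Then $M$ is conformally flat if and only if the following three conditions hold at every point of $M$ (in local coordinates with indices $a,b$ on the base and $\alpha,\beta$ on the fiber): (i) $\displaystyle \overline R=-\frac{\kappa}{2(n-1)(n-2)}\,\overline g\wedge\overline g+\frac1{n-2}\,\overline g\wedge\overline S-\frac{q}{n-2}\,\overline g\wedge T$; (ii) $\displaystyle \Big[\frac{f\kappa}{(n-1)(n-2)}-\frac{Q}{n-2}\Big]\overline g_{ab}\,\widetilde g_{\alpha\beta}-\frac1{n-2}\,\overline g_{ab}\,\widetilde S_{\alpha\beta}-\frac{f}{n-2}\,\overline S_{ab}\,\widetilde g_{\alpha\beta}+f\Big(\frac{q}{n-2}-1\Big)T_{ab}\,\widetilde g_{\alpha\beta}=0$; (iii) $\displaystyle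 \widetilde R=\Big[-\frac{f\kappa}{2(n-1)(n-2)}+\frac{Q}{n-2}+\frac{fP}{2}\Big]\widetilde g\wedge\widetilde g+\frac1{n-2}\,\widetilde g\wedge\widetilde S$. -/

import Mathlib

open scoped Manifold ContDiff

noncomputable section

/-! ## Tensor calculus in coordinates

`E` is the coordinate space, `b` a basis of `E` (the coordinate directions), and
`G : E → Matrix ι ι ℝ` the component matrix of a metric. -/

namespace Coord

section

variable {ι E : Type*} [Fintype ι] [DecidableEq ι] [NormedAddCommGroup E] [NormedSpace ℝ E]

/-- The partial derivative `∂ₖ F` at `u`. -/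
def pd (b : Module.Basis ι ℝ E) (k : ι) (F : E → ℝ) (u : E) : ℝ :=
  fderiv ℝ F u (b k)

/-- The Christoffel symbols `Γᵏᵢⱼ = ½ gᵏˡ (∂ᵢ gⱼₗ + ∂ⱼ gᵢₗ - ∂ₗ gᵢⱼ)` of the Levi-Civita
connection. -/
def christoffel (b : Module.Basis ι ℝ E) (G : E → Matrix ι ι ℝ) (k i j : ι) (u : E) : ℝ :=
  (1 / 2) * ∑ l, (G u)⁻¹ k l *
    (pd b i (fun v => G v j l) u + pd b j (fun v => G v i l) u - pd b l (fun v => G v i j) u)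

/-- The components of the Riemann-Christoffel curvature tensor,
`R_{hijk} = g_{hl} (∂ₖ Γˡᵢⱼ - ∂ⱼ Γˡᵢₖ + Γᵐᵢⱼ Γˡₘₖ - Γᵐᵢₖ Γˡₘⱼ)`. -/
def riemann (b : Module.Basis ι ℝ E) (G : E → Matrix ι ι ℝ) (h i j k : ι) (u : E) : ℝ :=
  ∑ l, G u h l *
    (pd b k (christoffel b G l i j) u - pd b j (christoffel b G l i k) u +
      ∑ m, (christoffel b G m i j u * christoffel b G l m k u -
        christoffel b G m i k u * christoffel b G l m j u))

/-- The components `∇_c ∂_a φ = ∂_c ∂_a φ - Γᵈ_{ac} ∂_d φ` of the Hessian of a function. -/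
def hessian (b : Module.Basis ι ℝ E) (G : E → Matrix ι ι ℝ) (φ : E → ℝ) (a c : ι) (u : E) : ℝ :=
  pd b c (pd b a φ) u - ∑ d, christoffel b G d a c u * pd b d φ u

end

end Coord

/-- The Kulkarni-Nomizu product of two `(0,2)` tensors (given by components at a point),
`(A ∧ B)_{ijkl} = A_{il} B_{jk} + A_{jk} B_{il} - A_{ik} B_{jl} - A_{jl} B_{ik}`. -/
def kulkarniNomizu {ι : Type*} (A B : ι → ι → ℝ) (i j k l : ι) : ℝ :=
  A i l * B j k + A j k * B i l - A i k * B j l - A j l * B i k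

/-! ## Semi-Riemannian manifolds -/

section

variable {E H : Type*} [NormedAddCommGroup E] [NormedSpace ℝ E] [TopologicalSpace H]
  (I : ModelWithCorners ℝ E H) {M : Type*} [TopologicalSpace M] [ChartedSpace H M]

/-- The coordinate vector in the direction `v` of the preferred chart at `x`, at the point whose
coordinates in that chart are `u`. -/
def coordVec (x : M) (u v : E) : TangentSpace I ((extChartAt I x).symm u) :=
  mfderivWithin 𝓘(ℝ, E) I (extChartAt I x).symm (Set.range I) u v

variable (M) in
/-- A smooth semi-Riemannian metric: a symmetric nondegenerate bilinear form on each tangent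
space, with smooth components in the charts. No assumption is made on the signature. -/
structure SemiRiemannianMetric where
  /-- the bilinear form on the tangent space at `x` -/
  form (x : M) : LinearMap.BilinForm ℝ (TangentSpace I x)
  symm (x : M) (v w : TangentSpace I x) : form x v w = form x w v
  nondegenerate (x : M) (v : TangentSpace I x) (hv : ∀ w, form x v w = 0) : v = 0
  smooth (x : M) (v w : E) : ContDiffOn ℝ ∞
    (fun u => form ((extChartAt I x).symm u) (coordVec I x u v) (coordVec I x u w))
    (extChartAt I x).target

end

namespace SemiRiemannianMetric

section

variable {E H M ι : Type*} [NormedAddCommGroup E] [NormedSpace ℝ E] [TopologicalSpace H]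
  {I : ModelWithCorners ℝ E H} [TopologicalSpace M] [ChartedSpace H M]
  [Fintype ι] [DecidableEq ι] (g : SemiRiemannianMetric I M) (b : Module.Basis ι ℝ E)

/-- The component matrix of `g` in the preferred chart at `x`, as a function of the
coordinates. -/
def comp (x : M) (u : E) : Matrix ι ι ℝ :=
  Matrix.of fun i j =>
    g.form ((extChartAt I x).symm u) (coordVec I x u (b i)) (coordVec I x u (b j))

/-! All tensors at `x` below are given by their components at `x` with respect to the coordinate
frame of the preferred chart at `x`. -/

/-- The components `g_{ij}` at `x`. -/
def metric (x : M) (i j : ι) : ℝ := g.comp b x (extChartAt I x x) i j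

/-- The components `gⁱʲ` of the inverse metric at `x`. -/
def inverse (x : M) (i j : ι) : ℝ := (g.comp b x (extChartAt I x x))⁻¹ i j

/-- The components `R_{hijk}` of the Riemann-Christoffel curvature tensor at `x`. -/
def riemann (x : M) (h i j k : ι) : ℝ := Coord.riemann b (g.comp b x) h i j k (extChartAt I x x)

/-- The components `S_{jk} = gⁱˡ R_{ijkl}` of the Ricci tensor at `x`. -/
def ricci (x : M) (j k : ι) : ℝ := ∑ i, ∑ l, g.inverse b x i l * g.riemann b x i j k l

/-- The scalar curvature `κ = gʲᵏ S_{jk}` at `x`. -/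
def scalar (x : M) : ℝ := ∑ j, ∑ k, g.inverse b x j k * g.ricci b x j k

/-- The conformal curvature tensor
`C = R - 1/(n-2) g ∧ S + κ/(2(n-1)(n-2)) g ∧ g`, where `n` is the dimension. -/
def conformalCurvature (x : M) (h i j k : ι) : ℝ :=
  let n : ℝ := Fintype.card ι
  g.riemann b x h i j k
    - 1 / (n - 2) * kulkarniNomizu (g.metric b x) (g.ricci b x) h i j k
    + g.scalar b x / (2 * (n - 1) * (n - 2)) *
      kulkarniNomizu (g.metric b x) (g.metric b x) h i j k

/-- The metric is flat: the curvature tensor vanishes identically. -/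
def IsFlat : Prop := ∀ (x : M) (h i j k : ι), g.riemann b x h i j k = 0

/-- The metric is conformally flat: the conformal curvature tensor vanishes identically. -/
def IsConformallyFlat : Prop := ∀ (x : M) (h i j k : ι), g.conformalCurvature b x h i j k = 0

/-- The partial derivatives `f_a = ∂_a f` at `x`. -/
def partialDeriv (_g : SemiRiemannianMetric I M) (f : M → ℝ) (x : M) (a : ι) : ℝ :=
  Coord.pd b a (f ∘ (extChartAt I x).symm) (extChartAt I x x)

/-- The second covariant derivatives `∇_c f_a` at `x`. -/
def hessian (f : M → ℝ) (x : M) (a c : ι) : ℝ :=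
  Coord.hessian b (g.comp b x) (f ∘ (extChartAt I x).symm) a c (extChartAt I x x)

/-- `T_{ac} = 1/(2f) (∇_c f_a - 1/(2f) f_a f_c)`. -/
def warpT (f : M → ℝ) (x : M) (a c : ι) : ℝ :=
  1 / (2 * f x) * (g.hessian b f x a c
    - 1 / (2 * f x) * (g.partialDeriv b f x a * g.partialDeriv b f x c))

/-- `tr T = gᵃᶜ T_{ac}`. -/
def warpTrT (f : M → ℝ) (x : M) : ℝ := ∑ a, ∑ c, g.inverse b x a c * g.warpT b f x a c

/-- `P = 1/(4f²) gᵃᶜ f_a f_c`. -/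
def warpP (f : M → ℝ) (x : M) : ℝ :=
  1 / (4 * f x ^ 2) *
    ∑ a, ∑ c, g.inverse b x a c * (g.partialDeriv b f x a * g.partialDeriv b f x c)

/-- `Q = -f ((q - 1) P + tr T)`, where `q` is the dimension of the fiber. -/
def warpQ (q : ℕ) (f : M → ℝ) (x : M) : ℝ :=
  -(f x) * (((q : ℝ) - 1) * g.warpP b f x + g.warpTrT b f x)

end

end SemiRiemannianMetric

/-! ## Warped products -/

section

variable {E H B E' H' F : Type*}
  [NormedAddCommGroup E] [NormedSpace ℝ E] [TopologicalSpace H] {I : ModelWithCorners ℝ E H}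
  [TopologicalSpace B] [ChartedSpace H B]
  [NormedAddCommGroup E'] [NormedSpace ℝ E'] [TopologicalSpace H'] {J : ModelWithCorners ℝ E' H'}
  [TopologicalSpace F] [ChartedSpace H' F]

/-- The bilinear forms `π^* gB + (f ∘ π) σ^* gF` on the tangent spaces of `B × F`, where `π` and
`σ` are the projections. -/
def warpedForm (gB : SemiRiemannianMetric I B) (gF : SemiRiemannianMetric J F) (f : B → ℝ)
    (z : B × F) : LinearMap.BilinForm ℝ (TangentSpace (I.prod J) z) :=
  (gB.form z.1).compl₁₂
      (mfderiv (I.prod J) I Prod.fst z).toLinearMap (mfderiv (I.prod J) I Prod.fst z).toLinearMap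
    + f z.1 • (gF.form z.2).compl₁₂
      (mfderiv (I.prod J) J Prod.snd z).toLinearMap (mfderiv (I.prod J) J Prod.snd z).toLinearMap

theorem warpedForm_apply (gB : SemiRiemannianMetric I B) (gF : SemiRiemannianMetric J F)
    (f : B → ℝ) (z : B × F) (v w : TangentSpace (I.prod J) z) :
    warpedForm gB gF f z v w =
      gB.form z.1 (Prod.fst v) (Prod.fst w) + f z.1 * gF.form z.2 (Prod.snd v) (Prod.snd w) := by
  unfold warpedForm
  rw [mfderiv_fst, mfderiv_snd]
  rfl

theorem coordVec_prod [IsManifold I ∞ B] [IsManifold J ∞ F] (z : B × F) (u : E × E')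
    (hu : u ∈ (extChartAt (I.prod J) z).target) (v : E × E') :
    coordVec (I.prod J) z u v = (coordVec I z.1 u.1 v.1, coordVec J z.2 u.2 v.2) := by
  have hu' : u.1 ∈ (extChartAt I z.1).target ∧ u.2 ∈ (extChartAt J z.2).target := by
    rw [extChartAt_prod] at hu
    exact hu
  have hI : IsManifold I 1 B := IsManifold.of_le (n := ∞) (by simp)
  have hJ : IsManifold J 1 F := IsManifold.of_le (n := ∞) (by simp)
  have h1 := mdifferentiableWithinAt_extChartAt_symm hu'.1
  have h2 := mdifferentiableWithinAt_extChartAt_symm hu'.2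
  have key := mfderivWithin_prodMap (p := u) h1 h2
    (I.uniqueMDiffOn _ (extChartAt_target_subset_range z.1 hu'.1))
    (J.uniqueMDiffOn _ (extChartAt_target_subset_range z.2 hu'.2))
  have key2 : mfderivWithin 𝓘(ℝ, E × E') (I.prod J) (extChartAt (I.prod J) z).symm
      (Set.range (I.prod J)) u =
      (mfderivWithin 𝓘(ℝ, E) I (extChartAt I z.1).symm (Set.range I) u.1).prodMap
        (mfderivWithin 𝓘(ℝ, E') J (extChartAt J z.2).symm (Set.range J) u.2) := by
    rw [← key, ModelWithCorners.range_prod, modelWithCornersSelf_prod, ← chartedSpaceSelf_prod]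
    rfl
  exact congrArg (fun L => L v) key2

theorem warpedForm_coordVec [IsManifold I ∞ B] [IsManifold J ∞ F]
    (gB : SemiRiemannianMetric I B) (gF : SemiRiemannianMetric J F)
    (f : B → ℝ) (z : B × F) (u : E × E') (hu : u ∈ (extChartAt (I.prod J) z).target)
    (v w : E × E') :
    warpedForm gB gF f ((extChartAt (I.prod J) z).symm u)
        (coordVec (I.prod J) z u v) (coordVec (I.prod J) z u w) =
      gB.form ((extChartAt I z.1).symm u.1) (coordVec I z.1 u.1 v.1) (coordVec I z.1 u.1 w.1)
        + f ((extChartAt I z.1).symm u.1) *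
          gF.form ((extChartAt J z.2).symm u.2)
            (coordVec J z.2 u.2 v.2) (coordVec J z.2 u.2 w.2) := by
  rw [coordVec_prod z u hu v, coordVec_prod z u hu w]
  exact warpedForm_apply gB gF f _ _ _

/-- The warped product `B ×_f F`: the product manifold `B × F` with the metric
`π^* gB + (f ∘ π) σ^* gF`. -/
def warpedProduct [IsManifold I ∞ B] [IsManifold J ∞ F]
    (gB : SemiRiemannianMetric I B) (gF : SemiRiemannianMetric J F) (f : B → ℝ)
    (hf : ContMDiff I 𝓘(ℝ, ℝ) ∞ f) (hpos : ∀ x, 0 < f x) :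
    SemiRiemannianMetric (I.prod J) (B × F) where
  form := warpedForm gB gF f
  symm z v w := by
    refine (warpedForm_apply gB gF f z v w).trans
      (Eq.trans ?_ (warpedForm_apply gB gF f z w v).symm)
    exact congrArg₂ (fun s t => s + f z.1 * t) (gB.symm _ _ _) (gF.symm _ _ _)
  nondegenerate z v hv := by
    have h1 : (Prod.fst v : E) = 0 := gB.nondegenerate z.1 (Prod.fst v) fun w => by
      have h := (warpedForm_apply gB gF f z v (w, (0 : E'))).symm.trans (hv (w, (0 : E')))
      have h0 : gF.form z.2 (Prod.snd v) 0 = 0 := map_zero _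
      have h' : gB.form z.1 (Prod.fst v) w + f z.1 * gF.form z.2 (Prod.snd v) 0 = 0 := h
      rwa [h0, mul_zero, add_zero] at h'
    have h2 : (Prod.snd v : E') = 0 := gF.nondegenerate z.2 (Prod.snd v) fun w => by
      have h := (warpedForm_apply gB gF f z v ((0 : E), w)).symm.trans (hv ((0 : E), w))
      have h0 : gB.form z.1 (Prod.fst v) 0 = 0 := map_zero _
      have h' : gB.form z.1 (Prod.fst v) 0 + f z.1 * gF.form z.2 (Prod.snd v) w = 0 := h
      rw [h0, zero_add] at h'
      exact (mul_eq_zero.mp h').resolve_left (hpos z.1).ne'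
    exact Prod.ext h1 h2
  smooth z v w := by
    have hfst : Set.MapsTo Prod.fst (extChartAt (I.prod J) z).target (extChartAt I z.1).target := by
      intro u hu
      rw [extChartAt_prod] at hu
      exact hu.1
    have hsnd : Set.MapsTo Prod.snd (extChartAt (I.prod J) z).target (extChartAt J z.2).target := by
      intro u hu
      rw [extChartAt_prod] at hu
      exact hu.2
    have hf' : ContDiffOn ℝ ∞ (fun u => f ((extChartAt I z.1).symm u))
        (extChartAt I z.1).target :=
      (hf.comp_contMDiffOn (contMDiffOn_extChartAt_symm z.1)).contDiffOn
    have hB := (gB.smooth z.1 v.1 w.1).comp contDiffOn_fst hfst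
    have hF := (gF.smooth z.2 v.2 w.2).comp contDiffOn_snd hsnd
    have hf2 := hf'.comp contDiffOn_fst hfst
    exact (hB.add (hf2.mul hF)).congr fun u hu => warpedForm_coordVec gB gF f z u hu v w

end

/-- The coordinate basis of `ℝᵈ`. -/
def stdBasis (d : ℕ) : Module.Basis (Fin d) ℝ (EuclideanSpace ℝ (Fin d)) :=
  (EuclideanSpace.basisFun (Fin d) ℝ).toBasis

/-- The coordinate basis of `ℝᵖ × ℝ^q`: the indices `Sum.inl a` belong to the base, the indices
`Sum.inr α` to the fiber of a product. -/
def prodBasis (p q : ℕ) : Module.Basis (Fin p ⊕ Fin q) ℝ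
    (EuclideanSpace ℝ (Fin p) × EuclideanSpace ℝ (Fin q)) :=
  (stdBasis p).prod (stdBasis q)

end

/-! In a product chart each index belongs to the base or to the fibre, and `C` can be examined block
by block. The warped metric is block diagonal with blocks `ḡ` and `f g̃`, and its Ricci tensor is
block diagonal too. Hence `R`, `g ∧ S` and `g ∧ g` all vanish unless the indices are all base, all
fibre, or split with one base and one fibre index in each antisymmetric pair. On these three kinds
of blocks `C` is, respectively, the difference of the two sides of (i), plus or minus the left side
of (ii), and `f` times the difference of the two sides of (iii). Since `f > 0`, both implications
follow pointwise. The scalar curvature `κ` enters only as a common symbol and is never expanded.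

The content is therefore the curvature of a warped product. The base block of `R` is `R̄`; the mixed
block is `R_{aαcβ} = f T_{ac} g̃_{αβ}` (`riemann_base_fiber_base_fiber`); the fibre block is `f R̃ -
(f² P / 2) g̃ ∧ g̃` (`riemann_fiber`). Tracing gives the Ricci blocks `S̄ - q T` and `S̃ + Q g̃`
(`warped_ricci_base`, `warped_ricci_fiber`). These are computed from Christoffel symbols on open
sets of the model space and carried to manifolds by `warped_comp_eventuallyEq` and `riemann_congr`.
-/

noncomputable section

namespace Coord

/-! ## Calculus of components -/

section Calculus

variable {ι κ E E' : Type*} [NormedAddCommGroup E] [NormedSpace ℝ E]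
  [NormedAddCommGroup E'] [NormedSpace ℝ E']
  (b : Module.Basis ι ℝ E) (b' : Module.Basis κ ℝ E')

theorem pd_congr {F F' : E → ℝ} {u : E} (h : F =ᶠ[nhds u] F') (k : ι) :
    pd b k F u = pd b k F' u := by
  rw [pd, pd, h.fderiv_eq]

theorem pd_zero (k : ι) (u : E) : pd b k (fun _ => (0 : ℝ)) u = 0 := by simp [pd]

theorem pd_mul {F F' : E → ℝ} {u : E} (hF : DifferentiableAt ℝ F u)
    (hF' : DifferentiableAt ℝ F' u) (k : ι) :
    pd b k (fun v => F v * F' v) u = pd b k F u * F' u + F u * pd b k F' u := by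
  simp only [pd, fderiv_fun_mul hF hF', add_apply,
    smul_apply, smul_eq_mul]
  ring

/-- Over a field, constants pass through `fderiv` unconditionally, so no differentiability of `F` is
required. -/
theorem pd_mul_const (F : E → ℝ) (c : ℝ) (u : E) (k : ι) :
    pd b k (fun v => F v * c) u = pd b k F u * c := by
  have h : (fun v => F v * c) = c • F := funext fun v => mul_comm (F v) c
  rw [pd, h, fderiv_const_smul_field]
  exact mul_comm _ _

theorem pd_sum {σ : Type*} (s : Finset σ) {F : σ → E → ℝ} {u : E}
    (hF : ∀ i ∈ s, DifferentiableAt ℝ (F i) u) (k : ι) :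
    pd b k (fun v => ∑ i ∈ s, F i v) u = ∑ i ∈ s, pd b k (F i) u := by
  simp [pd, fderiv_fun_sum hF]

theorem contDiffAt_pd {F : E → ℝ} {u : E} (hF : ContDiffAt ℝ ∞ F u) (k : ι) :
    ContDiffAt ℝ ∞ (pd b k F) u :=
  (hF.fderiv_right (m := ∞) (by simp)).clm_apply contDiffAt_const

theorem pd_pd_comm {F : E → ℝ} {u : E} (hF : ContDiffAt ℝ ∞ F u) (j k : ι) :
    pd b j (pd b k F) u = pd b k (pd b j F) u := by
  have hd : DifferentiableAt ℝ (fderiv ℝ F) u :=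
    (hF.fderiv_right (m := ∞) (by simp)).differentiableAt (by simp)
  have key : ∀ i l, pd b i (pd b l F) u = fderiv ℝ (fderiv ℝ F) u (b i) (b l) := fun i l => by
    change fderiv ℝ (fun v => fderiv ℝ F v (b l)) u (b i) = _
    rw [fderiv_clm_apply hd (differentiableAt_const _)]
    simp
  rw [key, key]
  exact hF.isSymmSndFDerivAt (by
    simpa using WithTop.coe_le_coe.2 (le_top : (2 : ℕ∞) ≤ ⊤)) (b j) (b k)

/-! ### Functions on a product that depend on one factor -/

/-- Restriction to a slice shows that the pullback is differentiable only if `F` is. Otherwise both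
derivatives take the default value `0`, so the identity is unconditional and Christoffel symbols can
be differentiated through it without regularity side goals. -/
theorem fderiv_comp_fst_apply (F : E → ℝ) (u w : E × E') :
    fderiv ℝ (fun v : E × E' => F v.1) u w = fderiv ℝ F u.1 w.1 := by
  by_cases hF : DifferentiableAt ℝ F u.1
  · have h := (hF.hasFDerivAt.comp u (hasFDerivAt_fst (𝕜 := ℝ) (p := u))).fderiv
    exact congrArg (fun L => L w) h
  · have h : ¬ DifferentiableAt ℝ (fun v : E × E' => F v.1) u := fun h => hF <| by
      have h' : DifferentiableAt ℝ (fun x : E => (x, u.2)) u.1 := by fun_prop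
      exact DifferentiableAt.comp (g := fun v : E × E' => F v.1) u.1 h h'
    rw [fderiv_zero_of_not_differentiableAt hF, fderiv_zero_of_not_differentiableAt h]
    simp

theorem fderiv_comp_snd_apply (F : E' → ℝ) (u w : E × E') :
    fderiv ℝ (fun v : E × E' => F v.2) u w = fderiv ℝ F u.2 w.2 := by
  by_cases hF : DifferentiableAt ℝ F u.2
  · have h := (hF.hasFDerivAt.comp u (hasFDerivAt_snd (𝕜 := ℝ) (p := u))).fderiv
    exact congrArg (fun L => L w) h
  · have h : ¬ DifferentiableAt ℝ (fun v : E × E' => F v.2) u := fun h => hF <| by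
      have h' : DifferentiableAt ℝ (fun x : E' => (u.1, x)) u.2 := by fun_prop
      exact DifferentiableAt.comp (g := fun v : E × E' => F v.2) u.2 h h'
    rw [fderiv_zero_of_not_differentiableAt hF, fderiv_zero_of_not_differentiableAt h]
    simp

theorem pd_inl_fst (F : E → ℝ) (u : E × E') (a : ι) :
    pd (b.prod b') (Sum.inl a) (fun v => F v.1) u = pd b a F u.1 := by
  simp [pd, fderiv_comp_fst_apply]

theorem pd_inr_fst (F : E → ℝ) (u : E × E') (α : κ) :
    pd (b.prod b') (Sum.inr α) (fun v => F v.1) u = 0 := by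
  simp [pd, fderiv_comp_fst_apply]

theorem pd_inl_snd (F : E' → ℝ) (u : E × E') (a : ι) :
    pd (b.prod b') (Sum.inl a) (fun v => F v.2) u = 0 := by
  simp [pd, fderiv_comp_snd_apply]

theorem pd_inr_snd (F : E' → ℝ) (u : E × E') (α : κ) :
    pd (b.prod b') (Sum.inr α) (fun v => F v.2) u = pd b' α F u.2 := by
  simp [pd, fderiv_comp_snd_apply]

theorem pd_inl_mul {F : E → ℝ} {F' : E' → ℝ} {u : E × E'} (hF : DifferentiableAt ℝ F u.1)
    (hF' : DifferentiableAt ℝ F' u.2) (a : ι) :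
    pd (b.prod b') (Sum.inl a) (fun v => F v.1 * F' v.2) u = pd b a F u.1 * F' u.2 := by
  rw [pd_mul _ (F := fun v : E × E' => F v.1) (F' := fun v : E × E' => F' v.2)
    (hF.comp u differentiableAt_fst) (hF'.comp u differentiableAt_snd), pd_inl_fst, pd_inl_snd]
  ring

theorem pd_inr_mul {F : E → ℝ} {F' : E' → ℝ} {u : E × E'} (hF : DifferentiableAt ℝ F u.1)
    (hF' : DifferentiableAt ℝ F' u.2) (α : κ) :
    pd (b.prod b') (Sum.inr α) (fun v => F v.1 * F' v.2) u = F u.1 * pd b' α F' u.2 := by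
  rw [pd_mul _ (F := fun v : E × E' => F v.1) (F' := fun v : E × E' => F' v.2)
    (hF.comp u differentiableAt_fst) (hF'.comp u differentiableAt_snd), pd_inr_fst, pd_inr_snd]
  ring

/-! ### Smoothness of the inverse matrix -/

theorem contDiffAt_det [Fintype ι] [DecidableEq ι] {G : E → Matrix ι ι ℝ} {u : E}
    (hG : ∀ i j, ContDiffAt ℝ ∞ (fun v => G v i j) u) :
    ContDiffAt ℝ ∞ (fun v => (G v).det) u := by
  simp only [Matrix.det_apply']
  exact ContDiffAt.sum fun σ _ => contDiffAt_const.mul <| contDiffAt_prod fun i _ => hG _ _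

theorem contDiffAt_inv_apply [Fintype ι] [DecidableEq ι] {G : E → Matrix ι ι ℝ} {u : E}
    (hG : ∀ i j, ContDiffAt ℝ ∞ (fun v => G v i j) u) (hdet : (G u).det ≠ 0) (i j : ι) :
    ContDiffAt ℝ ∞ (fun v => (G v)⁻¹ i j) u := by
  simp only [Matrix.inv_def, Matrix.smul_apply, Matrix.adjugate_apply, Ring.inverse_eq_inv',
    smul_eq_mul]
  -- Cramer's rule: an adjugate entry is the determinant of `G` with row `j` replaced by a constant
  -- row.
  refine ((contDiffAt_det hG).inv hdet).mul (contDiffAt_det fun k l => ?_)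
  by_cases h : k = j
  · subst h
    simpa using contDiffAt_const
  · simpa [Matrix.updateRow_ne h] using hG k l

end Calculus

/-! ## Metrics on open sets of the coordinate space -/

section Metric

variable {ι E : Type*} [Fintype ι] [DecidableEq ι] [NormedAddCommGroup E] [NormedSpace ℝ E]

/-- `G` is the component matrix of a smooth semi-Riemannian metric on the open set `U`. -/
structure IsMetricOn (G : E → Matrix ι ι ℝ) (U : Set E) : Prop where
  isOpen : IsOpen U
  symm : ∀ u ∈ U, ∀ i j, G u i j = G u j i
  det_ne_zero : ∀ u ∈ U, (G u).det ≠ 0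
  smooth : ∀ i j, ContDiffOn ℝ ∞ (fun u => G u i j) U

/-- The components `φᵈ = gᵈᵉ ∂ₑ φ` of the gradient of `φ`. -/
def gradient (b : Module.Basis ι ℝ E) (G : E → Matrix ι ι ℝ) (φ : E → ℝ) (d : ι) (u : E) : ℝ :=
  ∑ e, (G u)⁻¹ d e * pd b e φ u

variable {G G' : E → Matrix ι ι ℝ} {U : Set E} {u : E} (b : Module.Basis ι ℝ E)

theorem christoffel_congr (h : G =ᶠ[nhds u] G') (k i j : ι) :
    christoffel b G k i j u = christoffel b G' k i j u := by
  have h' : ∀ i j, (fun v => G v i j) =ᶠ[nhds u] fun v => G' v i j := fun i j =>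
    h.mono fun v hv => by simp only [hv]
  simp only [christoffel, h.eq_of_nhds, pd_congr b (h' _ _)]

/-- Curvature depends only on the germ of the metric. Agreement at `u` alone would not suffice: the
Christoffel symbols must agree near `u`, since they are differentiated once more. -/
theorem riemann_congr (h : G =ᶠ[nhds u] G') (i j k l : ι) :
    riemann b G i j k l u = riemann b G' i j k l u := by
  have h' : ∀ k i j, christoffel b G k i j =ᶠ[nhds u] christoffel b G' k i j := fun k i j =>
    h.eventuallyEq_nhds.mono fun v hv => christoffel_congr b hv k i j
  simp only [riemann, h.eq_of_nhds, pd_congr b (h' _ _ _), christoffel_congr b h]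

theorem riemann_swap (h i j k : ι) : riemann b G h i k j u = - riemann b G h i j k u := by
  simp only [riemann, ← Finset.sum_neg_distrib]
  refine Finset.sum_congr rfl fun l _ => ?_
  rw [← mul_neg, neg_add, ← Finset.sum_neg_distrib]
  congr 2
  · ring
  · exact Finset.sum_congr rfl fun m _ => by ring

theorem IsMetricOn.contDiffAt (hG : IsMetricOn G U) (hu : u ∈ U) (i j : ι) :
    ContDiffAt ℝ ∞ (fun v => G v i j) u :=
  (hG.smooth i j).contDiffAt (hG.isOpen.mem_nhds hu)

theorem IsMetricOn.differentiableAt (hG : IsMetricOn G U) (hu : u ∈ U) (i j : ι) :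
    DifferentiableAt ℝ (fun v => G v i j) u :=
  (hG.contDiffAt hu i j).differentiableAt (by simp)

theorem IsMetricOn.mul_inv (hG : IsMetricOn G U) (hu : u ∈ U) : G u * (G u)⁻¹ = 1 :=
  Matrix.mul_nonsing_inv _ (hG.det_ne_zero u hu).isUnit

theorem IsMetricOn.inv_mul (hG : IsMetricOn G U) (hu : u ∈ U) : (G u)⁻¹ * G u = 1 :=
  Matrix.nonsing_inv_mul _ (hG.det_ne_zero u hu).isUnit

/-- Lowering an index undoes raising it; this removes the inverse matrix from Christoffel symbols
and gradients. -/
theorem IsMetricOn.sum_mul_sum_inv_mul (hG : IsMetricOn G U) (hu : u ∈ U) (X : ι → ℝ) (i : ι) :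
    ∑ m, G u i m * ∑ l, (G u)⁻¹ m l * X l = X i := by
  have h : (G u).mulVec ((G u)⁻¹.mulVec X) = X := by
    rw [Matrix.mulVec_mulVec, hG.mul_inv hu, Matrix.one_mulVec]
  exact congrFun h i

theorem IsMetricOn.pd_symm (hG : IsMetricOn G U) (hu : u ∈ U) (k i j : ι) :
    pd b k (fun v => G v i j) u = pd b k (fun v => G v j i) u :=
  pd_congr b (Filter.eventually_of_mem (hG.isOpen.mem_nhds hu) fun v hv => hG.symm v hv i j) k

theorem IsMetricOn.christoffel_symm (hG : IsMetricOn G U) (hu : u ∈ U) (k i j : ι) :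
    christoffel b G k i j u = christoffel b G k j i u := by
  simp only [christoffel]
  congr 1
  refine Finset.sum_congr rfl fun l _ => ?_
  rw [hG.pd_symm b hu l i j]
  ring

theorem IsMetricOn.sum_mul_christoffel (hG : IsMetricOn G U) (hu : u ∈ U) (k i j : ι) :
    ∑ m, G u k m * christoffel b G m i j u = 1 / 2 * (pd b i (fun v => G v j k) u
      + pd b j (fun v => G v i k) u - pd b k (fun v => G v i j) u) := by
  rw [← hG.sum_mul_sum_inv_mul hu (fun l => pd b i (fun v => G v j l) u
      + pd b j (fun v => G v i l) u - pd b l (fun v => G v i j) u) k, Finset.mul_sum]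
  refine Finset.sum_congr rfl fun m _ => ?_
  simp only [christoffel]
  ring

/-- The metric is parallel for its Levi-Civita connection. -/
theorem IsMetricOn.pd_eq (hG : IsMetricOn G U) (hu : u ∈ U) (k i j : ι) :
    pd b k (fun v => G v i j) u =
      ∑ m, G u i m * christoffel b G m j k u + ∑ m, G u j m * christoffel b G m i k u := by
  rw [hG.sum_mul_christoffel b hu, hG.sum_mul_christoffel b hu, hG.pd_symm b hu k j i,
    hG.pd_symm b hu j k i, hG.pd_symm b hu i k j]
  ring

theorem IsMetricOn.sum_mul_gradient (hG : IsMetricOn G U) (hu : u ∈ U) (φ : E → ℝ) (a : ι) :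
    ∑ d, G u a d * gradient b G φ d u = pd b a φ u :=
  hG.sum_mul_sum_inv_mul hu (fun e => pd b e φ u) a

theorem IsMetricOn.differentiableAt_gradient (hG : IsMetricOn G U) (hu : u ∈ U) {φ : E → ℝ}
    (hφ : ContDiffOn ℝ ∞ φ U) (d : ι) : DifferentiableAt ℝ (gradient b G φ d) u := by
  unfold gradient
  have h : ContDiffAt ℝ ∞ φ u := hφ.contDiffAt (hG.isOpen.mem_nhds hu)
  exact DifferentiableAt.fun_sum fun e _ =>
    ((contDiffAt_inv_apply (hG.contDiffAt hu) (hG.det_ne_zero u hu) d e).differentiableAt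
      (by simp)).mul ((contDiffAt_pd b h e).differentiableAt (by simp))

/-- The Hessian of `φ` is the lowered covariant derivative of its gradient. -/
theorem IsMetricOn.hessian_eq (hG : IsMetricOn G U) (hu : u ∈ U) {φ : E → ℝ}
    (hφ : ContDiffOn ℝ ∞ φ U) (a c : ι) :
    ∑ d, G u a d * (pd b c (gradient b G φ d) u
      + ∑ m, gradient b G φ m u * christoffel b G d m c u) = hessian b G φ a c u := by
  -- The relation `φ_a = g_{ad} φᵈ` holds near `u`, so it may be differentiated by the product rule.
  have h1 : pd b c (pd b a φ) u = ∑ d, (pd b c (fun v => G v a d) u * gradient b G φ d u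
      + G u a d * pd b c (gradient b G φ d) u) := by
    rw [← pd_congr b (F := fun v => ∑ d, G v a d * gradient b G φ d v)
      (Filter.eventually_of_mem (hG.isOpen.mem_nhds hu) fun v hv => hG.sum_mul_gradient b hv φ a),
      pd_sum b _ (F := fun d v => G v a d * gradient b G φ d v) fun d _ =>
        (hG.differentiableAt hu a d).mul (hG.differentiableAt_gradient b hu hφ d)]
    exact Finset.sum_congr rfl fun d _ =>
      pd_mul b (hG.differentiableAt hu a d) (hG.differentiableAt_gradient b hu hφ d) c
  have h2 : ∑ d, christoffel b G d a c u * pd b d φ u =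
      ∑ d, (∑ m, G u d m * christoffel b G m a c u) * gradient b G φ d u := by
    simp_rw [← hG.sum_mul_gradient b hu φ, Finset.mul_sum, Finset.sum_mul]
    rw [Finset.sum_comm]
    refine Finset.sum_congr rfl fun d _ => Finset.sum_congr rfl fun m _ => ?_
    rw [hG.symm u hu m d]
    ring
  have h3 : ∑ d, G u a d * ∑ m, gradient b G φ m u * christoffel b G d m c u =
      ∑ d, (∑ m, G u a m * christoffel b G m d c u) * gradient b G φ d u := by
    simp_rw [Finset.mul_sum, Finset.sum_mul]
    rw [Finset.sum_comm]
    exact Finset.sum_congr rfl fun d _ => Finset.sum_congr rfl fun m _ => by ring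
  rw [hessian, h1, h2]
  simp_rw [mul_add]
  rw [Finset.sum_add_distrib, h3, ← Finset.sum_sub_distrib, ← Finset.sum_add_distrib]
  refine Finset.sum_congr rfl fun d _ => ?_
  -- As the metric is parallel, `∂_c g_{ad}` is a sum of two Christoffel terms: one is the
  -- correction in the Hessian (`h2`), the other the correction in the derivative of the gradient
  -- (`h3`).
  rw [hG.pd_eq b hu c a d]
  ring

end Metric

/-! ## Warped products in coordinates -/

section Warped

variable {ι κ E E' : Type*}

/-- The component matrix of the warped product metric. -/
def warpedMatrix (A : E → Matrix ι ι ℝ) (C : E' → Matrix κ κ ℝ) (φ : E → ℝ) (v : E × E') :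
    Matrix (ι ⊕ κ) (ι ⊕ κ) ℝ :=
  Matrix.fromBlocks (A v.1) 0 0 (φ v.1 • C v.2)

section

variable {A : E → Matrix ι ι ℝ} {C : E' → Matrix κ κ ℝ} {φ : E → ℝ}

@[simp]
theorem warpedMatrix_inl_inl (v : E × E') (i j : ι) :
    warpedMatrix A C φ v (Sum.inl i) (Sum.inl j) = A v.1 i j := rfl

@[simp]
theorem warpedMatrix_inl_inr (v : E × E') (i : ι) (j : κ) :
    warpedMatrix A C φ v (Sum.inl i) (Sum.inr j) = 0 := rfl

@[simp]
theorem warpedMatrix_inr_inl (v : E × E') (i : κ) (j : ι) :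
    warpedMatrix A C φ v (Sum.inr i) (Sum.inl j) = 0 := rfl

@[simp]
theorem warpedMatrix_inr_inr (v : E × E') (i j : κ) :
    warpedMatrix A C φ v (Sum.inr i) (Sum.inr j) = φ v.1 * C v.2 i j := rfl

end

variable [Fintype ι] [DecidableEq ι] [Fintype κ] [DecidableEq κ]
  [NormedAddCommGroup E] [NormedSpace ℝ E] [NormedAddCommGroup E'] [NormedSpace ℝ E']

/-- The components `T_{ac} = 1/(2φ) (∇_c φ_a - 1/(2φ) φ_a φ_c)`. -/
def warpTensor (b : Module.Basis ι ℝ E) (A : E → Matrix ι ι ℝ) (φ : E → ℝ) (a c : ι) (u : E) : ℝ :=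
  1 / (2 * φ u) * (hessian b A φ a c u - 1 / (2 * φ u) * (pd b a φ u * pd b c φ u))

variable {A : E → Matrix ι ι ℝ} {C : E' → Matrix κ κ ℝ} {φ : E → ℝ} {U : Set E} {V : Set E'}

/-- The data of a warped product of metrics on `U` and `V`. -/
structure IsWarpedOn (A : E → Matrix ι ι ℝ) (C : E' → Matrix κ κ ℝ) (φ : E → ℝ) (U : Set E)
    (V : Set E') : Prop where
  base : IsMetricOn A U
  fiber : IsMetricOn C V
  smooth : ContDiffOn ℝ ∞ φ U
  pos : ∀ u ∈ U, 0 < φ u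

namespace IsWarpedOn

variable {u : E × E'} (hW : IsWarpedOn A C φ U V) (b : Module.Basis ι ℝ E)
  (b' : Module.Basis κ ℝ E')

include hW

theorem contDiffAt {x : E} (hx : x ∈ U) : ContDiffAt ℝ ∞ φ x :=
  hW.smooth.contDiffAt (hW.base.isOpen.mem_nhds hx)

theorem differentiableAt {x : E} (hx : x ∈ U) : DifferentiableAt ℝ φ x :=
  (hW.contDiffAt hx).differentiableAt (by simp)

theorem warpedMatrix_inv (hu : u ∈ U ×ˢ V) :
    (warpedMatrix A C φ u)⁻¹ =
      Matrix.fromBlocks (A u.1)⁻¹ 0 0 ((φ u.1)⁻¹ • (C u.2)⁻¹) := by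
  refine Matrix.inv_eq_right_inv ?_
  rw [warpedMatrix, Matrix.fromBlocks_multiply]
  simp [hW.base.mul_inv hu.1, hW.fiber.mul_inv hu.2, (hW.pos _ hu.1).ne']

theorem warpedMatrix_inv_inl_inl (hu : u ∈ U ×ˢ V) (i j : ι) :
    (warpedMatrix A C φ u)⁻¹ (Sum.inl i) (Sum.inl j) = (A u.1)⁻¹ i j := by
  rw [hW.warpedMatrix_inv hu]; rfl

theorem warpedMatrix_inv_inl_inr (hu : u ∈ U ×ˢ V) (i : ι) (j : κ) :
    (warpedMatrix A C φ u)⁻¹ (Sum.inl i) (Sum.inr j) = 0 := by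
  rw [hW.warpedMatrix_inv hu]; rfl

theorem warpedMatrix_inv_inr_inl (hu : u ∈ U ×ˢ V) (i : κ) (j : ι) :
    (warpedMatrix A C φ u)⁻¹ (Sum.inr i) (Sum.inl j) = 0 := by
  rw [hW.warpedMatrix_inv hu]; rfl

theorem warpedMatrix_inv_inr_inr (hu : u ∈ U ×ˢ V) (i j : κ) :
    (warpedMatrix A C φ u)⁻¹ (Sum.inr i) (Sum.inr j) = (φ u.1)⁻¹ * (C u.2)⁻¹ i j := by
  rw [hW.warpedMatrix_inv hu]; rfl

theorem pd_inl_smul_apply (hu : u ∈ U ×ˢ V) (a : ι) (i j : κ) :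
    pd (b.prod b') (Sum.inl a) (fun v => φ v.1 * C v.2 i j) u = pd b a φ u.1 * C u.2 i j :=
  pd_inl_mul b b' (F' := fun w => C w i j) (hW.differentiableAt hu.1)
    (hW.fiber.differentiableAt hu.2 i j) a

theorem pd_inr_smul_apply (hu : u ∈ U ×ˢ V) (α i j : κ) :
    pd (b.prod b') (Sum.inr α) (fun v => φ v.1 * C v.2 i j) u =
      φ u.1 * pd b' α (fun w => C w i j) u.2 :=
  pd_inr_mul b b' (F' := fun w => C w i j) (hW.differentiableAt hu.1)
    (hW.fiber.differentiableAt hu.2 i j) α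

/-! ### Christoffel symbols -/

theorem christoffel_base (hu : u ∈ U ×ˢ V) (k i j : ι) :
    christoffel (b.prod b') (warpedMatrix A C φ) (Sum.inl k) (Sum.inl i) (Sum.inl j) u =
      christoffel b A k i j u.1 := by
  simp [christoffel, hW.warpedMatrix_inv_inl_inl hu, hW.warpedMatrix_inv_inl_inr hu,
    fun i j k => pd_inl_fst b b' (fun v => A v i j) u k]

theorem christoffel_base_mixed (hu : u ∈ U ×ˢ V) (k i : ι) (β : κ) :
    christoffel (b.prod b') (warpedMatrix A C φ) (Sum.inl k) (Sum.inl i) (Sum.inr β) u = 0 := by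
  simp [christoffel, hW.warpedMatrix_inv_inl_inl hu, hW.warpedMatrix_inv_inl_inr hu,
    fun i j k => pd_inr_fst b b' (fun v => A v i j) u k, pd_zero]

theorem christoffel_base_mixed' (hu : u ∈ U ×ˢ V) (k i : ι) (β : κ) :
    christoffel (b.prod b') (warpedMatrix A C φ) (Sum.inl k) (Sum.inr β) (Sum.inl i) u = 0 := by
  simp [christoffel, hW.warpedMatrix_inv_inl_inl hu, hW.warpedMatrix_inv_inl_inr hu,
    fun i j k => pd_inr_fst b b' (fun v => A v i j) u k, pd_zero]

/-- Only `-∂_l (φ g̃_{αβ})` survives; this is the second fundamental form of the fibres. The value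
is kept as a base function times a fibre function, so that `pd_inl_mul` and `pd_inr_mul`
differentiate it. -/
theorem christoffel_base_fiber (hu : u ∈ U ×ˢ V) (k : ι) (α β : κ) :
    christoffel (b.prod b') (warpedMatrix A C φ) (Sum.inl k) (Sum.inr α) (Sum.inr β) u =
      gradient b A φ k u.1 * (-(1 / 2) * C u.2 α β) := by
  simp only [christoffel, Fintype.sum_sum_type, hW.warpedMatrix_inv_inl_inl hu,
    hW.warpedMatrix_inv_inl_inr hu, warpedMatrix_inr_inl, warpedMatrix_inr_inr, pd_zero,
    hW.pd_inl_smul_apply b b' hu, gradient, Finset.sum_mul]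
  simp only [zero_mul, Finset.sum_const_zero, add_zero, Finset.mul_sum]
  exact Finset.sum_congr rfl fun l _ => by ring

theorem christoffel_fiber_base (hu : u ∈ U ×ˢ V) (γ : κ) (i j : ι) :
    christoffel (b.prod b') (warpedMatrix A C φ) (Sum.inr γ) (Sum.inl i) (Sum.inl j) u = 0 := by
  simp [christoffel, hW.warpedMatrix_inv_inr_inl hu, hW.warpedMatrix_inv_inr_inr hu,
    fun i j k => pd_inr_fst b b' (fun v => A v i j) u k, pd_zero]

theorem sum_inv_mul (hu : u.2 ∈ V) (γ β : κ) :
    ∑ l, (C u.2)⁻¹ γ l * C u.2 l β = if γ = β then 1 else 0 := by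
  rw [← Matrix.mul_apply, hW.fiber.inv_mul hu, Matrix.one_apply]

/-- Only `∂_a (φ g̃_{βl})` survives. Contraction with `φ⁻¹ g̃^{γl}` leaves half the logarithmic
derivative of `φ` times the identity. -/
theorem christoffel_fiber_mixed' (hu : u ∈ U ×ˢ V) (γ β : κ) (a : ι) :
    christoffel (b.prod b') (warpedMatrix A C φ) (Sum.inr γ) (Sum.inr β) (Sum.inl a) u =
      (1 / (2 * φ u.1) * pd b a φ u.1) * if γ = β then 1 else 0 := by
  have hφ := (hW.pos _ hu.1).ne'
  simp only [christoffel, Fintype.sum_sum_type, hW.warpedMatrix_inv_inr_inl hu,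
    hW.warpedMatrix_inv_inr_inr hu, warpedMatrix_inr_inl, warpedMatrix_inl_inr,
    warpedMatrix_inr_inr, pd_zero,
    hW.pd_inl_smul_apply b b' hu, ← hW.sum_inv_mul hu.2]
  simp only [zero_mul, Finset.sum_const_zero, zero_add, add_zero, sub_zero, Finset.mul_sum]
  refine Finset.sum_congr rfl fun l _ => ?_
  rw [hW.fiber.symm _ hu.2 β l]
  field_simp

theorem christoffel_fiber_mixed (hu : u ∈ U ×ˢ V) (γ β : κ) (a : ι) :
    christoffel (b.prod b') (warpedMatrix A C φ) (Sum.inr γ) (Sum.inl a) (Sum.inr β) u =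
      (1 / (2 * φ u.1) * pd b a φ u.1) * if γ = β then 1 else 0 := by
  rw [← hW.christoffel_fiber_mixed' b b' hu]
  simp [christoffel, hW.warpedMatrix_inv_inr_inl hu, hW.warpedMatrix_inv_inr_inr hu, pd_zero]

theorem christoffel_fiber (hu : u ∈ U ×ˢ V) (γ α β : κ) :
    christoffel (b.prod b') (warpedMatrix A C φ) (Sum.inr γ) (Sum.inr α) (Sum.inr β) u =
      christoffel b' C γ α β u.2 := by
  have hφ := (hW.pos _ hu.1).ne'
  simp only [christoffel, Fintype.sum_sum_type, hW.warpedMatrix_inv_inr_inl hu,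
    hW.warpedMatrix_inv_inr_inr hu, warpedMatrix_inr_inr,
    hW.pd_inr_smul_apply b b' hu]
  simp only [zero_mul, Finset.sum_const_zero, zero_add]
  congr 1
  refine Finset.sum_congr rfl fun l _ => ?_
  field_simp

/-! ### Derivatives of the Christoffel symbols -/

/-- The Christoffel formulas hold on an open set, which is what permits differentiating them. -/
theorem eventually_mem (hu : u ∈ U ×ˢ V) : ∀ᶠ v in nhds u, v ∈ U ×ˢ V :=
  (hW.base.isOpen.prod hW.fiber.isOpen).mem_nhds hu

theorem pd_christoffel_base (hu : u ∈ U ×ˢ V) (k i j l : ι) :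
    pd (b.prod b') (Sum.inl l)
      (christoffel (b.prod b') (warpedMatrix A C φ) (Sum.inl k) (Sum.inl i) (Sum.inl j)) u =
      pd b l (christoffel b A k i j) u.1 := by
  rw [pd_congr _ ((hW.eventually_mem hu).mono fun v hv => hW.christoffel_base b b' hv k i j),
    pd_inl_fst]

theorem pd_inr_christoffel_base (hu : u ∈ U ×ˢ V) (k i j : ι) (γ : κ) :
    pd (b.prod b') (Sum.inr γ)
      (christoffel (b.prod b') (warpedMatrix A C φ) (Sum.inl k) (Sum.inl i) (Sum.inl j)) u = 0 := by
  rw [pd_congr _ ((hW.eventually_mem hu).mono fun v hv => hW.christoffel_base b b' hv k i j),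
    pd_inr_fst b b' (christoffel b A k i j)]

theorem pd_christoffel_base_mixed (hu : u ∈ U ×ˢ V) (k i : ι) (β : κ) (s : ι ⊕ κ) :
    pd (b.prod b') s
      (christoffel (b.prod b') (warpedMatrix A C φ) (Sum.inl k) (Sum.inl i) (Sum.inr β)) u = 0 := by
  rw [pd_congr _ ((hW.eventually_mem hu).mono fun v hv => hW.christoffel_base_mixed b b' hv k i β),
    pd_zero]

theorem pd_christoffel_base_mixed' (hu : u ∈ U ×ˢ V) (k i : ι) (β : κ) (s : ι ⊕ κ) :
    pd (b.prod b') s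
      (christoffel (b.prod b') (warpedMatrix A C φ) (Sum.inl k) (Sum.inr β) (Sum.inl i)) u = 0 := by
  rw [pd_congr _ ((hW.eventually_mem hu).mono fun v hv => hW.christoffel_base_mixed' b b' hv k i β),
    pd_zero]

theorem pd_inl_christoffel_base_fiber (hu : u ∈ U ×ˢ V) (k c : ι) (α β : κ) :
    pd (b.prod b') (Sum.inl c)
      (christoffel (b.prod b') (warpedMatrix A C φ) (Sum.inl k) (Sum.inr α) (Sum.inr β)) u =
      pd b c (gradient b A φ k) u.1 * (-(1 / 2) * C u.2 α β) := by
  rw [pd_congr _ ((hW.eventually_mem hu).mono fun v hv =>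
      hW.christoffel_base_fiber b b' hv k α β),
    pd_inl_mul b b' (F := gradient b A φ k) (F' := fun w => -(1 / 2) * C w α β)
      (hW.base.differentiableAt_gradient b hu.1 hW.smooth k)
      ((hW.fiber.differentiableAt hu.2 α β).const_mul _)]

theorem pd_inr_christoffel_base_fiber (hu : u ∈ U ×ˢ V) (k : ι) (α β γ : κ) :
    pd (b.prod b') (Sum.inr γ)
      (christoffel (b.prod b') (warpedMatrix A C φ) (Sum.inl k) (Sum.inr α) (Sum.inr β)) u =
      gradient b A φ k u.1 * (-(1 / 2) * pd b' γ (fun w => C w α β) u.2) := by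
  rw [pd_congr _ ((hW.eventually_mem hu).mono fun v hv =>
      hW.christoffel_base_fiber b b' hv k α β),
    pd_inr_mul b b' (F := gradient b A φ k) (F' := fun w => -(1 / 2) * C w α β)
      (hW.base.differentiableAt_gradient b hu.1 hW.smooth k)
      ((hW.fiber.differentiableAt hu.2 α β).const_mul _)]
  simp_rw [mul_comm (-(1 / 2) : ℝ), pd_mul_const]

theorem pd_christoffel_fiber_base (hu : u ∈ U ×ˢ V) (γ : κ) (i j : ι) (s : ι ⊕ κ) :
    pd (b.prod b') s
      (christoffel (b.prod b') (warpedMatrix A C φ) (Sum.inr γ) (Sum.inl i) (Sum.inl j)) u = 0 := by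
  rw [pd_congr _ ((hW.eventually_mem hu).mono fun v hv => hW.christoffel_fiber_base b b' hv γ i j),
    pd_zero]

/-- This is the second derivative of `½ log φ`, the source of the quadratic term of `T` when the
first curvature index lies in the fibre. -/
theorem pd_log_deriv {x : E} (hx : x ∈ U) (a c : ι) :
    pd b c (fun v => 1 / (2 * φ v) * pd b a φ v) x =
      1 / (2 * φ x) * pd b c (pd b a φ) x - 1 / (2 * φ x ^ 2) * (pd b a φ x * pd b c φ x) := by
  have hφ := (hW.pos _ hx).ne'
  have h1 := (hW.differentiableAt hx).hasFDerivAt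
  have h2 : HasFDerivAt (fun v => 1 / (2 * φ v)) (-(1 / (2 * φ x ^ 2)) • fderiv ℝ φ x) x := by
    have h := ((hasDerivAt_inv hφ).comp_hasFDerivAt x h1).const_mul (1 / 2 : ℝ)
    refine (h.congr_fderiv ?_).congr_of_eventuallyEq (Filter.Eventually.of_forall fun v => ?_)
    · rw [smul_smul]
      congr 1
      field_simp
    · simp [mul_comm]
  rw [pd_mul b h2.differentiableAt
    ((contDiffAt_pd b (hW.contDiffAt hx) a).differentiableAt (by simp))]
  have h3 : pd b c (fun v => 1 / (2 * φ v)) x = -(1 / (2 * φ x ^ 2)) * pd b c φ x := by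
    rw [pd, h2.fderiv]; rfl
  rw [h3]
  ring

theorem pd_inl_christoffel_fiber_mixed (hu : u ∈ U ×ˢ V) (γ β : κ) (a c : ι) :
    pd (b.prod b') (Sum.inl c)
      (christoffel (b.prod b') (warpedMatrix A C φ) (Sum.inr γ) (Sum.inl a) (Sum.inr β)) u =
      (1 / (2 * φ u.1) * pd b c (pd b a φ) u.1 - 1 / (2 * φ u.1 ^ 2) *
        (pd b a φ u.1 * pd b c φ u.1)) * if γ = β then 1 else 0 := by
  rw [pd_congr _ ((hW.eventually_mem hu).mono fun v hv =>
      hW.christoffel_fiber_mixed b b' hv γ β a), pd_mul_const,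
    pd_inl_fst b b' (fun v => 1 / (2 * φ v) * pd b a φ v), hW.pd_log_deriv b hu.1]

theorem pd_inl_christoffel_fiber_mixed' (hu : u ∈ U ×ˢ V) (γ β : κ) (a c : ι) :
    pd (b.prod b') (Sum.inl c)
      (christoffel (b.prod b') (warpedMatrix A C φ) (Sum.inr γ) (Sum.inr β) (Sum.inl a)) u =
      (1 / (2 * φ u.1) * pd b c (pd b a φ) u.1 - 1 / (2 * φ u.1 ^ 2) *
        (pd b a φ u.1 * pd b c φ u.1)) * if γ = β then 1 else 0 := by
  rw [pd_congr _ ((hW.eventually_mem hu).mono fun v hv =>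
      hW.christoffel_fiber_mixed' b b' hv γ β a), pd_mul_const,
    pd_inl_fst b b' (fun v => 1 / (2 * φ v) * pd b a φ v), hW.pd_log_deriv b hu.1]

theorem pd_inr_christoffel_fiber_mixed (hu : u ∈ U ×ˢ V) (γ β δ : κ) (a : ι) :
    pd (b.prod b') (Sum.inr δ)
      (christoffel (b.prod b') (warpedMatrix A C φ) (Sum.inr γ) (Sum.inl a) (Sum.inr β)) u = 0 := by
  rw [pd_congr _ ((hW.eventually_mem hu).mono fun v hv =>
      hW.christoffel_fiber_mixed b b' hv γ β a), pd_mul_const,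
    pd_inr_fst b b' (fun v => 1 / (2 * φ v) * pd b a φ v), zero_mul]

theorem pd_inr_christoffel_fiber_mixed' (hu : u ∈ U ×ˢ V) (γ β δ : κ) (a : ι) :
    pd (b.prod b') (Sum.inr δ)
      (christoffel (b.prod b') (warpedMatrix A C φ) (Sum.inr γ) (Sum.inr β) (Sum.inl a)) u = 0 := by
  rw [pd_congr _ ((hW.eventually_mem hu).mono fun v hv =>
      hW.christoffel_fiber_mixed' b b' hv γ β a), pd_mul_const,
    pd_inr_fst b b' (fun v => 1 / (2 * φ v) * pd b a φ v), zero_mul]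

theorem pd_inl_christoffel_fiber (hu : u ∈ U ×ˢ V) (γ α β : κ) (c : ι) :
    pd (b.prod b') (Sum.inl c)
      (christoffel (b.prod b') (warpedMatrix A C φ) (Sum.inr γ) (Sum.inr α) (Sum.inr β)) u = 0 := by
  rw [pd_congr _ ((hW.eventually_mem hu).mono fun v hv => hW.christoffel_fiber b b' hv γ α β),
    pd_inl_snd b b' (christoffel b' C γ α β)]

theorem pd_inr_christoffel_fiber (hu : u ∈ U ×ˢ V) (γ α β δ : κ) :
    pd (b.prod b') (Sum.inr δ)
      (christoffel (b.prod b') (warpedMatrix A C φ) (Sum.inr γ) (Sum.inr α) (Sum.inr β)) u =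
      pd b' δ (christoffel b' C γ α β) u.2 := by
  rw [pd_congr _ ((hW.eventually_mem hu).mono fun v hv => hW.christoffel_fiber b b' hv γ α β),
    pd_inr_snd]

end IsWarpedOn

end Warped

section WarpedCurvature

variable {ι κ E E' : Type*} [Fintype ι] [DecidableEq ι] [Fintype κ] [DecidableEq κ]
  [NormedAddCommGroup E] [NormedSpace ℝ E] [NormedAddCommGroup E'] [NormedSpace ℝ E']
  {A : E → Matrix ι ι ℝ} {C : E' → Matrix κ κ ℝ} {φ : E → ℝ} {U : Set E} {V : Set E'}

namespace IsWarpedOn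

variable {u : E × E'} (hW : IsWarpedOn A C φ U V) (b : Module.Basis ι ℝ E)
  (b' : Module.Basis κ ℝ E')

include hW

/-! ### Curvature components -/

theorem riemann_base (hu : u ∈ U ×ˢ V) (h i j k : ι) :
    riemann (b.prod b') (warpedMatrix A C φ) (Sum.inl h) (Sum.inl i) (Sum.inl j) (Sum.inl k) u =
      riemann b A h i j k u.1 := by
  simp [riemann, hW.christoffel_base b b' hu, hW.christoffel_fiber_base b b' hu,
    hW.pd_christoffel_base b b' hu]

theorem riemann_base_base_base_fiber (hu : u ∈ U ×ˢ V) (h i j : ι) (κ : κ) :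
    riemann (b.prod b') (warpedMatrix A C φ) (Sum.inl h) (Sum.inl i) (Sum.inl j) (Sum.inr κ) u =
      0 := by
  simp [riemann, hW.christoffel_base_mixed b b' hu, hW.christoffel_base_mixed' b b' hu,
    hW.christoffel_fiber_base b b' hu,
    hW.pd_inr_christoffel_base b b' hu, hW.pd_christoffel_base_mixed b b' hu]

theorem riemann_base_base_fiber_fiber (hu : u ∈ U ×ˢ V) (h i : ι) (β γ : κ) :
    riemann (b.prod b') (warpedMatrix A C φ) (Sum.inl h) (Sum.inl i) (Sum.inr β) (Sum.inr γ) u =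
      0 := by
  simp [riemann, hW.christoffel_base_mixed b b' hu, hW.christoffel_fiber_mixed b b' hu,
    hW.christoffel_base_fiber b b' hu, hW.pd_christoffel_base_mixed b b' hu,
    hW.fiber.symm _ hu.2 β γ]

theorem riemann_base_fiber_base_base (hu : u ∈ U ×ˢ V) (h : ι) (α : κ) (j k : ι) :
    riemann (b.prod b') (warpedMatrix A C φ) (Sum.inl h) (Sum.inr α) (Sum.inl j) (Sum.inl k) u =
      0 := by
  simp [riemann, hW.christoffel_base_mixed' b b' hu, hW.pd_christoffel_base_mixed' b b' hu]

/-- Differentiating `Γᵈ_{αβ} = -½ φᵈ g̃_{αβ}` covariantly along the base gives `½ g̃_{αβ}` times the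
Hessian. The product `Γ^μ_{αc} Γᵈ_{μβ}`, with `μ` in the fibre, supplies the term in `φ_a φ_c`. -/
theorem riemann_base_fiber_base_fiber (hu : u ∈ U ×ˢ V) (a : ι) (α : κ) (c : ι) (β : κ) :
    riemann (b.prod b') (warpedMatrix A C φ) (Sum.inl a) (Sum.inr α) (Sum.inl c) (Sum.inr β) u =
      φ u.1 * warpTensor b A φ a c u.1 * C u.2 α β := by
  have hφ := (hW.pos _ hu.1).ne'
  simp only [riemann, hW.christoffel_base_mixed' b b' hu, hW.christoffel_base_fiber b b' hu,
    hW.christoffel_fiber_mixed' b b' hu, hW.christoffel_base b b' hu,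
    hW.pd_christoffel_base_mixed' b b' hu, hW.pd_inl_christoffel_base_fiber b b' hu,
    Fintype.sum_sum_type, warpedMatrix_inl_inl, warpedMatrix_inl_inr, zero_mul,
    Finset.sum_const_zero, add_zero, zero_sub, Finset.sum_neg_distrib, mul_ite, mul_one, mul_zero,
    ite_mul, sub_zero, Finset.sum_ite_eq', Finset.mem_univ, if_true, warpTensor]
  -- Both the Hessian and `φ_a` are written as lowered gradients, so that the two sides become sums
  -- over the same index `d`.
  rw [← hW.base.hessian_eq b hu.1 hW.smooth a c, ← hW.base.sum_mul_gradient b hu.1 φ a]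
  -- The inner sum is made opaque, so that distributing products over sums does not expand it.
  obtain ⟨X, hX⟩ : ∃ X : ι → ℝ, ∀ d,
      ∑ m, gradient b A φ m u.1 * christoffel b A d m c u.1 = X d := ⟨_, fun _ => rfl⟩
  have hX' : ∀ d, ∑ m, gradient b A φ m u.1 * (-(1 / 2) * C u.2 α β) * christoffel b A d m c u.1
      = -(1 / 2) * C u.2 α β * X d := fun d => by
    rw [← hX, Finset.mul_sum]
    exact Finset.sum_congr rfl fun m _ => by ring
  simp only [hX, hX', Finset.sum_mul, Finset.mul_sum, ← Finset.sum_sub_distrib]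
  refine Finset.sum_congr rfl fun d _ => ?_
  field_simp
  ring

/-- A Codazzi identity: the second fundamental form is a multiple of the parallel fibre metric, with
a factor constant along the fibre. The Christoffel terms of `∂ g̃` cancel against the quadratic
terms and, by symmetry of `Γ`, against each other. -/
theorem riemann_base_fiber_fiber_fiber (hu : u ∈ U ×ˢ V) (a : ι) (α β γ : κ) :
    riemann (b.prod b') (warpedMatrix A C φ) (Sum.inl a) (Sum.inr α) (Sum.inr β) (Sum.inr γ) u =
      0 := by
  simp only [riemann, hW.christoffel_base_mixed b b' hu, hW.christoffel_base_fiber b b' hu,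
    hW.christoffel_fiber b b' hu,
    hW.pd_inr_christoffel_base_fiber b b' hu,
    Fintype.sum_sum_type, warpedMatrix_inl_inl, warpedMatrix_inl_inr, zero_mul, mul_zero, sub_zero,
    Finset.sum_const_zero, add_zero, zero_add, hW.fiber.pd_eq b' hu.2]
  refine Finset.sum_eq_zero fun l _ => ?_
  have h : ∑ x, (christoffel b' C x α β u.2 * (gradient b A φ l u.1 * (-(1 / 2) * C u.2 x γ)) -
      christoffel b' C x α γ u.2 * (gradient b A φ l u.1 * (-(1 / 2) * C u.2 x β))) =
      gradient b A φ l u.1 * (-(1 / 2) * (∑ m, C u.2 γ m * christoffel b' C m α β u.2 -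
        ∑ m, C u.2 β m * christoffel b' C m α γ u.2)) := by
    rw [← Finset.sum_sub_distrib, Finset.mul_sum, Finset.mul_sum]
    refine Finset.sum_congr rfl fun m _ => ?_
    rw [hW.fiber.symm _ hu.2 m γ, hW.fiber.symm _ hu.2 m β]
    ring
  simp only [h, hW.fiber.christoffel_symm b' hu.2 _ γ β]
  ring

theorem riemann_fiber_base_base_base (hu : u ∈ U ×ˢ V) (α : κ) (i j k : ι) :
    riemann (b.prod b') (warpedMatrix A C φ) (Sum.inr α) (Sum.inl i) (Sum.inl j) (Sum.inl k) u =
      0 := by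
  simp [riemann, hW.christoffel_fiber_base b b' hu, hW.pd_christoffel_fiber_base b b' hu]

/-- Antisymmetry in the first pair is not visible in the coordinate formula, so this block is
computed independently. Here `T` comes from the derivative of `φ_a / (2φ)`, and the Hessian appears
directly, without the gradient. -/
theorem riemann_fiber_base_base_fiber (hu : u ∈ U ×ˢ V) (α : κ) (a c : ι) (β : κ) :
    riemann (b.prod b') (warpedMatrix A C φ) (Sum.inr α) (Sum.inl a) (Sum.inl c) (Sum.inr β) u =
      -(φ u.1 * warpTensor b A φ a c u.1 * C u.2 α β) := by
  have hφ := (hW.pos _ hu.1).ne'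
  simp only [riemann, hW.christoffel_fiber_base b b' hu, hW.christoffel_base b b' hu,
    hW.christoffel_base_mixed b b' hu, hW.christoffel_fiber_mixed b b' hu,
    hW.christoffel_fiber_mixed' b b' hu, hW.pd_christoffel_fiber_base b b' hu,
    hW.pd_inl_christoffel_fiber_mixed b b' hu,
    Fintype.sum_sum_type, warpedMatrix_inr_inl, warpedMatrix_inr_inr, zero_mul, sub_zero,
    Finset.sum_const_zero, zero_sub, Finset.sum_neg_distrib, mul_ite, mul_one, mul_zero,
    zero_add, warpTensor, hessian]
  rw [Finset.sum_eq_single β (fun l _ hl => by simp [hl]) (fun h => absurd (Finset.mem_univ _) h)]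
  simp only [if_true, Finset.sum_ite_eq, Finset.mem_univ]
  have h : ∑ x, christoffel b A x a c u.1 * (1 / (2 * φ u.1) * pd b x φ u.1) =
      1 / (2 * φ u.1) * ∑ d, christoffel b A d a c u.1 * pd b d φ u.1 := by
    rw [Finset.mul_sum]
    exact Finset.sum_congr rfl fun m _ => by ring
  rw [h]
  field_simp
  ring

theorem riemann_fiber_base_fiber_fiber (hu : u ∈ U ×ˢ V) (α : κ) (a : ι) (β γ : κ) :
    riemann (b.prod b') (warpedMatrix A C φ) (Sum.inr α) (Sum.inl a) (Sum.inr β) (Sum.inr γ) u =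
      0 := by
  simp [riemann, hW.christoffel_base_mixed b b' hu, hW.christoffel_fiber_mixed b b' hu,
    hW.christoffel_fiber b b' hu, hW.pd_inr_christoffel_fiber_mixed b b' hu,
    hW.fiber.christoffel_symm b' hu.2 _ β γ]

/-- The form `dφ / (2φ)` is closed: the second partials of `φ` commute and the quadratic terms are
symmetric in `j` and `k`. -/
theorem riemann_fiber_fiber_base_base (hu : u ∈ U ×ˢ V) (α β : κ) (j k : ι) :
    riemann (b.prod b') (warpedMatrix A C φ) (Sum.inr α) (Sum.inr β) (Sum.inl j) (Sum.inl k) u =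
      0 := by
  simp [riemann, hW.christoffel_base_mixed' b b' hu, hW.christoffel_fiber_mixed' b b' hu,
    hW.pd_inl_christoffel_fiber_mixed' b b' hu, pd_pd_comm b (hW.contDiffAt hu.1) j k]
  refine Finset.sum_eq_zero fun l _ => ?_
  split_ifs <;> ring

theorem riemann_fiber_fiber_base_fiber (hu : u ∈ U ×ˢ V) (α β : κ) (c : ι) (γ : κ) :
    riemann (b.prod b') (warpedMatrix A C φ) (Sum.inr α) (Sum.inr β) (Sum.inl c) (Sum.inr γ) u =
      0 := by
  simp [riemann, hW.christoffel_base_mixed' b b' hu, hW.christoffel_fiber_mixed' b b' hu,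
    hW.christoffel_fiber b b' hu, hW.christoffel_fiber_base b b' hu,
    hW.pd_inl_christoffel_fiber b b' hu, hW.pd_inr_christoffel_fiber_mixed' b b' hu]
  exact Finset.sum_eq_zero fun l _ => by ring

/-- The Gauss equation of the fibre: its rescaled intrinsic curvature, corrected by a term quadratic
in the second fundamental form. -/
theorem riemann_fiber (hu : u ∈ U ×ˢ V) (α β γ δ : κ) :
    riemann (b.prod b') (warpedMatrix A C φ) (Sum.inr α) (Sum.inr β) (Sum.inr γ) (Sum.inr δ) u =
      φ u.1 * riemann b' C α β γ δ u.2 - 1 / 4 * (∑ m, gradient b A φ m u.1 * pd b m φ u.1) *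
        (C u.2 β γ * C u.2 α δ - C u.2 β δ * C u.2 α γ) := by
  have hφ := (hW.pos _ hu.1).ne'
  simp only [riemann, hW.christoffel_base_fiber b b' hu, hW.christoffel_fiber_mixed b b' hu,
    hW.christoffel_fiber b b' hu, hW.pd_inr_christoffel_fiber b b' hu,
    Fintype.sum_sum_type, warpedMatrix_inr_inl, warpedMatrix_inr_inr, zero_mul,
    Finset.sum_const_zero, zero_add, mul_ite, mul_one, mul_zero]
  simp only [mul_add, Finset.sum_add_distrib, Finset.mul_sum (a := φ u.1), ← mul_assoc (φ u.1)]
  -- This is the contribution of `Γᵐ_{βγ} Γˡ_{mδ} - Γᵐ_{βδ} Γˡ_{mγ}` with `m` in the base; all terms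
  -- with `m` in the fibre belong to the fibre curvature.
  have h : ∑ l, φ u.1 * C u.2 α l *
      ∑ x, ((if l = δ then gradient b A φ x u.1 * (-(1 / 2) * C u.2 β γ) *
          (1 / (2 * φ u.1) * pd b x φ u.1) else 0) -
        if l = γ then gradient b A φ x u.1 * (-(1 / 2) * C u.2 β δ) *
          (1 / (2 * φ u.1) * pd b x φ u.1) else 0) =
      -(1 / 4 * (∑ m, gradient b A φ m u.1 * pd b m φ u.1) *
        (C u.2 β γ * C u.2 α δ - C u.2 β δ * C u.2 α γ)) := by
    simp only [Finset.mul_sum, mul_sub, Finset.sum_sub_distrib]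
    rw [Finset.sum_comm, Finset.sum_comm (f := fun l x => φ u.1 * C u.2 α l * if l = γ then _ else 0)]
    simp only [mul_ite, mul_zero, Finset.sum_ite_eq', Finset.mem_univ, if_true]
    rw [← Finset.sum_sub_distrib, Finset.sum_mul, Finset.sum_mul, ← Finset.sum_sub_distrib,
      ← Finset.sum_neg_distrib]
    refine Finset.sum_congr rfl fun m _ => ?_
    field_simp
    ring
  rw [h]
  ring

end IsWarpedOn

end WarpedCurvature

end Coord

/-! ### Gram matrices and coordinate vectors -/

/-- A row vector killed by the Gram matrix gives the coefficients of a vector pairing to zero with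
the whole basis, hence with everything. -/
theorem LinearMap.BilinForm.det_ne_zero_of_separatingLeft {ι W : Type*} [Fintype ι] [DecidableEq ι]
    [AddCommGroup W] [Module ℝ W] (β : LinearMap.BilinForm ℝ W)
    (hβ : ∀ v, (∀ w, β v w = 0) → v = 0) (c : Module.Basis ι ℝ W) :
    (Matrix.of fun i j => β (c i) (c j)).det ≠ 0 := fun hdet => by
  obtain ⟨v, hv0, hv⟩ := Matrix.exists_vecMul_eq_zero_iff.2 hdet
  have h : β (∑ i, v i • c i) = 0 := c.ext fun j => by
    simpa [Matrix.vecMul, dotProduct] using congrFun hv j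
  have h0 := hβ (∑ i, v i • c i) fun w => by rw [h, LinearMap.zero_apply]
  exact hv0 (funext (Fintype.linearIndependent_iff.1 c.linearIndependent v h0))

theorem coordVec_zero {E H M : Type*} [NormedAddCommGroup E] [NormedSpace ℝ E] [TopologicalSpace H]
    (I : ModelWithCorners ℝ E H) [TopologicalSpace M] [ChartedSpace H M] (x : M) (u : E) :
    coordVec I x u 0 = 0 := map_zero _

namespace SemiRiemannianMetric

/-! ## Components of a semi-Riemannian metric at a point -/

theorem metric_symm {E H M ι : Type*} [NormedAddCommGroup E] [NormedSpace ℝ E]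
    [TopologicalSpace H] {I : ModelWithCorners ℝ E H} [TopologicalSpace M] [ChartedSpace H M]
    (g : SemiRiemannianMetric I M) (b : Module.Basis ι ℝ E) (x : M) (i j : ι) :
    g.metric b x i j = g.metric b x j i := g.symm _ _ _

section

variable {E H M ι : Type*} [NormedAddCommGroup E] [NormedSpace ℝ E] [TopologicalSpace H]
  {I : ModelWithCorners ℝ E H} [TopologicalSpace M] [ChartedSpace H M]
  [Fintype ι] [DecidableEq ι] (g : SemiRiemannianMetric I M) (b : Module.Basis ι ℝ E)

theorem isMetricOn_comp [I.Boundaryless] [IsManifold I ∞ M] (x : M) :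
    Coord.IsMetricOn (g.comp b x) (extChartAt I x).target where
  isOpen := isOpen_extChartAt_target x
  symm _ _ _ _ := g.symm _ _ _
  smooth i j := g.smooth x (b i) (b j)
  det_ne_zero u hu := by
    have : IsManifold I 1 M := IsManifold.of_le (n := ∞) (by simp)
    -- The derivative of the inverse chart is invertible, so the coordinate vectors form a basis of
    -- the tangent space, and nondegeneracy of the form becomes a nonzero determinant.
    obtain ⟨L, hL⟩ := isInvertible_mfderivWithin_extChartAt_symm hu
    let c : Module.Basis ι ℝ (TangentSpace I ((extChartAt I x).symm u)) :=
      Module.Basis.map (M := TangentSpace 𝓘(ℝ, E) u) b L.toLinearEquiv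
    have hc : ∀ i, coordVec I x u (b i) = c i := fun i => (congrArg (fun L => L (b i)) hL).symm
    have h := (g.form ((extChartAt I x).symm u)).det_ne_zero_of_separatingLeft
      (g.nondegenerate _) c
    simpa only [comp, hc] using h

theorem riemann_swap (x : M) (h i j k : ι) :
    g.riemann b x h i k j = - g.riemann b x h i j k :=
  Coord.riemann_swap b h i j k

theorem conformalCurvature_swap (x : M) (h i j k : ι) :
    g.conformalCurvature b x h i k j = - g.conformalCurvature b x h i j k := by
  simp only [conformalCurvature, kulkarniNomizu, g.riemann_swap b x h i j k]
  ring

variable [I.Boundaryless] [IsManifold I ∞ M]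

theorem sum_inverse_mul_metric (x : M) (i j : ι) :
    ∑ k, g.inverse b x i k * g.metric b x k j = if i = j then 1 else 0 := by
  have h := (g.isMetricOn_comp b x).inv_mul (mem_extChartAt_target x)
  exact (congrFun (congrFun h i) j).trans (Matrix.one_apply ..)

theorem sum_sum_inverse_mul_metric (x : M) :
    ∑ i, ∑ j, g.inverse b x i j * g.metric b x i j = Fintype.card ι := by
  have h : ∀ i, ∑ j, g.inverse b x i j * g.metric b x i j = 1 := fun i =>
    (Finset.sum_congr rfl fun j _ => by rw [g.metric_symm b x i j]).trans
      ((g.sum_inverse_mul_metric b x i i).trans (if_pos rfl))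
  simp [h]

/-- The cross term in the trace of `g ∧ g`; it turns the factor `q` into `q - 1` in `Q`. -/
theorem sum_sum_inverse_mul_metric_mul_metric (x : M) (k l : ι) :
    ∑ i, ∑ j, g.inverse b x i j * (g.metric b x k j * g.metric b x i l) = g.metric b x k l := by
  have h : ∀ i, ∑ j, g.inverse b x i j * (g.metric b x k j * g.metric b x i l) =
      (if i = k then 1 else 0) * g.metric b x i l := fun i => by
    rw [← g.sum_inverse_mul_metric b x i k, Finset.sum_mul]
    exact Finset.sum_congr rfl fun j _ => by rw [g.metric_symm b x k j]; ring
  simp [h]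

end

/-! ## Curvature of a warped product -/

section

open Coord

variable {E H B E' H' F ι κ : Type*}
  [NormedAddCommGroup E] [NormedSpace ℝ E] [TopologicalSpace H] {I : ModelWithCorners ℝ E H}
  [TopologicalSpace B] [ChartedSpace H B]
  [NormedAddCommGroup E'] [NormedSpace ℝ E'] [TopologicalSpace H'] {J : ModelWithCorners ℝ E' H'}
  [TopologicalSpace F] [ChartedSpace H' F]

theorem mem_target_prod_target (x : B) (y : F) : (extChartAt I x x, extChartAt J y y) ∈
    (extChartAt I x).target ×ˢ (extChartAt J y).target :=
  ⟨mem_extChartAt_target x, mem_extChartAt_target y⟩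

theorem comp_extChartAt_symm_apply (f : B → ℝ) (x : B) :
    (f ∘ (extChartAt I x).symm) (extChartAt I x x) = f x :=
  congrArg f (extChartAt_to_inv x)

theorem warpTensor_eq_warpT [Fintype ι] [DecidableEq ι]
    (gB : SemiRiemannianMetric I B) (f : B → ℝ) (b : Module.Basis ι ℝ E) (x : B) (a c : ι) :
    warpTensor b (gB.comp b x) (f ∘ (extChartAt I x).symm) a c (extChartAt I x x) =
      gB.warpT b f x a c := by
  rw [warpTensor, comp_extChartAt_symm_apply]
  rfl

theorem sum_gradient_mul_pd [Fintype ι] [DecidableEq ι] (gB : SemiRiemannianMetric I B) (f : B → ℝ)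
    (hpos : ∀ x, 0 < f x) (b : Module.Basis ι ℝ E) (x : B) :
    ∑ m, Coord.gradient b (gB.comp b x) (f ∘ (extChartAt I x).symm) m (extChartAt I x x) *
        pd b m (f ∘ (extChartAt I x).symm) (extChartAt I x x) =
      4 * f x ^ 2 * gB.warpP b f x := by
  have hfx := (hpos x).ne'
  have h : 4 * f x ^ 2 * gB.warpP b f x = ∑ a, ∑ c, gB.inverse b x a c *
      (gB.partialDeriv b f x a * gB.partialDeriv b f x c) := by
    rw [warpP]
    field_simp
  rw [h]
  refine Finset.sum_congr rfl fun a _ => ?_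
  rw [Coord.gradient, Finset.sum_mul]
  refine Finset.sum_congr rfl fun c _ => ?_
  change gB.inverse b x a c * gB.partialDeriv b f x c * gB.partialDeriv b f x a = _
  ring

variable [IsManifold I ∞ B] [IsManifold J ∞ F] [I.Boundaryless] [J.Boundaryless]
  (gB : SemiRiemannianMetric I B) (gF : SemiRiemannianMetric J F) (f : B → ℝ)
  (hf : ContMDiff I 𝓘(ℝ, ℝ) ∞ f) (hpos : ∀ x, 0 < f x)
  (b : Module.Basis ι ℝ E) (b' : Module.Basis κ ℝ E') (x : B) (y : F)

/-- The product chart is a product of charts, and its coordinate vectors have a zero component in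
one factor. Agreement near the point, not just at it, is what `riemann_congr` needs. -/
theorem warped_comp_eventuallyEq :
    (warpedProduct gB gF f hf hpos).comp (b.prod b') (x, y)
      =ᶠ[nhds (extChartAt I x x, extChartAt J y y)]
      warpedMatrix (gB.comp b x) (gF.comp b' y) (f ∘ (extChartAt I x).symm) := by
  refine Filter.eventually_of_mem
    (((isOpen_extChartAt_target x).prod (isOpen_extChartAt_target y)).mem_nhds
      ⟨mem_extChartAt_target x, mem_extChartAt_target y⟩) fun u hu => ?_
  have hu' : u ∈ (extChartAt (I.prod J) (x, y)).target := by
    rw [extChartAt_prod]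
    exact hu
  ext i j
  refine (warpedForm_coordVec gB gF f (x, y) u hu' _ _).trans ?_
  have hB : ∀ e, gB.form ((extChartAt I x).symm u.1) e 0 = 0 := fun e => map_zero _
  have hF : ∀ e, gF.form ((extChartAt J y).symm u.2) e 0 = 0 := fun e => map_zero _
  have hB' : ∀ e, gB.form ((extChartAt I x).symm u.1) 0 e = 0 := fun e => by rw [gB.symm, hB]
  have hF' : ∀ e, gF.form ((extChartAt J y).symm u.2) 0 e = 0 := fun e => by rw [gF.symm, hF]
  rcases i with i | i <;> rcases j with j | j <;>
    simp only [Module.Basis.prod_apply_inl_fst, Module.Basis.prod_apply_inl_snd,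
      Module.Basis.prod_apply_inr_fst, Module.Basis.prod_apply_inr_snd, coordVec_zero, hB, hF, hB',
      hF', mul_zero, add_zero, zero_add, warpedMatrix_inl_inl, warpedMatrix_inl_inr,
      warpedMatrix_inr_inl, warpedMatrix_inr_inr, comp, Matrix.of_apply, Function.comp_apply]

theorem warped_metric (i j : ι ⊕ κ) :
    (warpedProduct gB gF f hf hpos).metric (b.prod b') (x, y) i j =
      warpedMatrix (gB.comp b x) (gF.comp b' y) (f ∘ (extChartAt I x).symm)
        (extChartAt I x x, extChartAt J y y) i j :=
  congrFun (congrFun (warped_comp_eventuallyEq gB gF f hf hpos b b' x y).eq_of_nhds i) j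

theorem warped_metric_base (i j : ι) :
    (warpedProduct gB gF f hf hpos).metric (b.prod b') (x, y) (Sum.inl i) (Sum.inl j) =
      gB.metric b x i j :=
  warped_metric gB gF f hf hpos b b' x y _ _

theorem warped_metric_base_fiber (i : ι) (j : κ) :
    (warpedProduct gB gF f hf hpos).metric (b.prod b') (x, y) (Sum.inl i) (Sum.inr j) = 0 :=
  warped_metric gB gF f hf hpos b b' x y _ _

theorem warped_metric_fiber_base (i : κ) (j : ι) :
    (warpedProduct gB gF f hf hpos).metric (b.prod b') (x, y) (Sum.inr i) (Sum.inl j) = 0 :=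
  warped_metric gB gF f hf hpos b b' x y _ _

theorem warped_metric_fiber (i j : κ) :
    (warpedProduct gB gF f hf hpos).metric (b.prod b') (x, y) (Sum.inr i) (Sum.inr j) =
      f x * gF.metric b' y i j := by
  rw [warped_metric, warpedMatrix_inr_inr, comp_extChartAt_symm_apply]
  rfl

variable [Fintype ι] [DecidableEq ι] [Fintype κ] [DecidableEq κ]

include hf hpos in
theorem isWarpedOn :
    IsWarpedOn (gB.comp b x) (gF.comp b' y) (f ∘ (extChartAt I x).symm) (extChartAt I x).target
      (extChartAt J y).target where
  base := gB.isMetricOn_comp b x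
  fiber := gF.isMetricOn_comp b' y
  smooth := (hf.comp_contMDiffOn (contMDiffOn_extChartAt_symm x)).contDiffOn
  pos _ _ := hpos _

theorem warped_inverse (i j : ι ⊕ κ) :
    (warpedProduct gB gF f hf hpos).inverse (b.prod b') (x, y) i j =
      (warpedMatrix (gB.comp b x) (gF.comp b' y) (f ∘ (extChartAt I x).symm)
        (extChartAt I x x, extChartAt J y y))⁻¹ i j :=
  congrArg (fun A : Matrix (ι ⊕ κ) (ι ⊕ κ) ℝ => A⁻¹ i j)
    (warped_comp_eventuallyEq gB gF f hf hpos b b' x y).eq_of_nhds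

theorem warped_riemann (h i j k : ι ⊕ κ) :
    (warpedProduct gB gF f hf hpos).riemann (b.prod b') (x, y) h i j k =
      Coord.riemann (b.prod b')
        (warpedMatrix (gB.comp b x) (gF.comp b' y) (f ∘ (extChartAt I x).symm)) h i j k
        (extChartAt I x x, extChartAt J y y) :=
  Coord.riemann_congr _ (warped_comp_eventuallyEq gB gF f hf hpos b b' x y) h i j k

theorem warped_inverse_base (i j : ι) :
    (warpedProduct gB gF f hf hpos).inverse (b.prod b') (x, y) (Sum.inl i) (Sum.inl j) =
      gB.inverse b x i j := by
  rw [warped_inverse, (isWarpedOn gB gF f hf hpos b b' x y).warpedMatrix_inv_inl_inl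
      (mem_target_prod_target x y)]
  rfl

theorem warped_inverse_base_fiber (i : ι) (j : κ) :
    (warpedProduct gB gF f hf hpos).inverse (b.prod b') (x, y) (Sum.inl i) (Sum.inr j) = 0 := by
  rw [warped_inverse, (isWarpedOn gB gF f hf hpos b b' x y).warpedMatrix_inv_inl_inr
      (mem_target_prod_target x y)]

theorem warped_inverse_fiber_base (i : κ) (j : ι) :
    (warpedProduct gB gF f hf hpos).inverse (b.prod b') (x, y) (Sum.inr i) (Sum.inl j) = 0 := by
  rw [warped_inverse, (isWarpedOn gB gF f hf hpos b b' x y).warpedMatrix_inv_inr_inl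
      (mem_target_prod_target x y)]

theorem warped_inverse_fiber (i j : κ) :
    (warpedProduct gB gF f hf hpos).inverse (b.prod b') (x, y) (Sum.inr i) (Sum.inr j) =
      (f x)⁻¹ * gF.inverse b' y i j := by
  rw [warped_inverse, (isWarpedOn gB gF f hf hpos b b' x y).warpedMatrix_inv_inr_inr
      (mem_target_prod_target x y),
    comp_extChartAt_symm_apply]
  rfl

end

section

open Coord

variable {E H B E' H' F ι κ : Type*}
  [NormedAddCommGroup E] [NormedSpace ℝ E] [TopologicalSpace H] {I : ModelWithCorners ℝ E H}
  [TopologicalSpace B] [ChartedSpace H B]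
  [NormedAddCommGroup E'] [NormedSpace ℝ E'] [TopologicalSpace H'] {J : ModelWithCorners ℝ E' H'}
  [TopologicalSpace F] [ChartedSpace H' F]
  [IsManifold I ∞ B] [IsManifold J ∞ F] [I.Boundaryless] [J.Boundaryless]
  [Fintype ι] [DecidableEq ι] [Fintype κ] [DecidableEq κ]
  (gB : SemiRiemannianMetric I B) (gF : SemiRiemannianMetric J F) (f : B → ℝ)
  (hf : ContMDiff I 𝓘(ℝ, ℝ) ∞ f) (hpos : ∀ x, 0 < f x)
  (b : Module.Basis ι ℝ E) (b' : Module.Basis κ ℝ E') (x : B) (y : F)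

/-! ### The Riemann-Christoffel tensor -/

theorem warped_riemann_base (h i j k : ι) :
    (warpedProduct gB gF f hf hpos).riemann (b.prod b') (x, y)
      (Sum.inl h) (Sum.inl i) (Sum.inl j) (Sum.inl k) = gB.riemann b x h i j k :=
  (warped_riemann ..).trans ((isWarpedOn gB gF f hf hpos b b' x y).riemann_base b b'
    (mem_target_prod_target x y) h i j k)

theorem warped_riemann_base_base_base_fiber (h i j : ι) (δ : κ) :
    (warpedProduct gB gF f hf hpos).riemann (b.prod b') (x, y)
      (Sum.inl h) (Sum.inl i) (Sum.inl j) (Sum.inr δ) = 0 :=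
  (warped_riemann ..).trans ((isWarpedOn gB gF f hf hpos b b' x y).riemann_base_base_base_fiber b b'
    (mem_target_prod_target x y) h i j δ)

theorem warped_riemann_base_base_fiber_fiber (h i : ι) (γ δ : κ) :
    (warpedProduct gB gF f hf hpos).riemann (b.prod b') (x, y)
      (Sum.inl h) (Sum.inl i) (Sum.inr γ) (Sum.inr δ) = 0 :=
  (warped_riemann ..).trans ((isWarpedOn gB gF f hf hpos b b' x y).riemann_base_base_fiber_fiber
    b b' (mem_target_prod_target x y) h i γ δ)

theorem warped_riemann_base_fiber_base_base (h : ι) (α : κ) (j k : ι) :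
    (warpedProduct gB gF f hf hpos).riemann (b.prod b') (x, y)
      (Sum.inl h) (Sum.inr α) (Sum.inl j) (Sum.inl k) = 0 :=
  (warped_riemann ..).trans ((isWarpedOn gB gF f hf hpos b b' x y).riemann_base_fiber_base_base
    b b' (mem_target_prod_target x y) h α j k)

theorem warped_riemann_base_fiber_base_fiber (a : ι) (α : κ) (c : ι) (β : κ) :
    (warpedProduct gB gF f hf hpos).riemann (b.prod b') (x, y)
      (Sum.inl a) (Sum.inr α) (Sum.inl c) (Sum.inr β) =
      f x * gB.warpT b f x a c * gF.metric b' y α β := by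
  rw [warped_riemann, (isWarpedOn gB gF f hf hpos b b' x y).riemann_base_fiber_base_fiber b b'
    (mem_target_prod_target x y), warpTensor_eq_warpT, comp_extChartAt_symm_apply]
  rfl

theorem warped_riemann_base_fiber_fiber_fiber (a : ι) (α β γ : κ) :
    (warpedProduct gB gF f hf hpos).riemann (b.prod b') (x, y)
      (Sum.inl a) (Sum.inr α) (Sum.inr β) (Sum.inr γ) = 0 :=
  (warped_riemann ..).trans ((isWarpedOn gB gF f hf hpos b b' x y).riemann_base_fiber_fiber_fiber
    b b' (mem_target_prod_target x y) a α β γ)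

theorem warped_riemann_fiber_base_base_base (α : κ) (i j k : ι) :
    (warpedProduct gB gF f hf hpos).riemann (b.prod b') (x, y)
      (Sum.inr α) (Sum.inl i) (Sum.inl j) (Sum.inl k) = 0 :=
  (warped_riemann ..).trans ((isWarpedOn gB gF f hf hpos b b' x y).riemann_fiber_base_base_base
    b b' (mem_target_prod_target x y) α i j k)

theorem warped_riemann_fiber_base_base_fiber (α : κ) (a c : ι) (β : κ) :
    (warpedProduct gB gF f hf hpos).riemann (b.prod b') (x, y)
      (Sum.inr α) (Sum.inl a) (Sum.inl c) (Sum.inr β) =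
      -(f x * gB.warpT b f x a c * gF.metric b' y α β) := by
  rw [warped_riemann, (isWarpedOn gB gF f hf hpos b b' x y).riemann_fiber_base_base_fiber b b'
    (mem_target_prod_target x y), warpTensor_eq_warpT, comp_extChartAt_symm_apply]
  rfl

theorem warped_riemann_fiber_base_fiber_fiber (α : κ) (a : ι) (β γ : κ) :
    (warpedProduct gB gF f hf hpos).riemann (b.prod b') (x, y)
      (Sum.inr α) (Sum.inl a) (Sum.inr β) (Sum.inr γ) = 0 :=
  (warped_riemann ..).trans ((isWarpedOn gB gF f hf hpos b b' x y).riemann_fiber_base_fiber_fiber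
    b b' (mem_target_prod_target x y) α a β γ)

theorem warped_riemann_fiber_fiber_base_base (α β : κ) (j k : ι) :
    (warpedProduct gB gF f hf hpos).riemann (b.prod b') (x, y)
      (Sum.inr α) (Sum.inr β) (Sum.inl j) (Sum.inl k) = 0 :=
  (warped_riemann ..).trans ((isWarpedOn gB gF f hf hpos b b' x y).riemann_fiber_fiber_base_base
    b b' (mem_target_prod_target x y) α β j k)

theorem warped_riemann_fiber_fiber_base_fiber (α β : κ) (c : ι) (γ : κ) :
    (warpedProduct gB gF f hf hpos).riemann (b.prod b') (x, y)
      (Sum.inr α) (Sum.inr β) (Sum.inl c) (Sum.inr γ) = 0 :=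
  (warped_riemann ..).trans ((isWarpedOn gB gF f hf hpos b b' x y).riemann_fiber_fiber_base_fiber
    b b' (mem_target_prod_target x y) α β c γ)

theorem warped_riemann_fiber (α β γ δ : κ) :
    (warpedProduct gB gF f hf hpos).riemann (b.prod b') (x, y)
      (Sum.inr α) (Sum.inr β) (Sum.inr γ) (Sum.inr δ) =
      f x * gF.riemann b' y α β γ δ - f x ^ 2 * gB.warpP b f x *
        (gF.metric b' y β γ * gF.metric b' y α δ - gF.metric b' y β δ * gF.metric b' y α γ) := by
  rw [warped_riemann, (isWarpedOn gB gF f hf hpos b b' x y).riemann_fiber b b'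
    (mem_target_prod_target x y), sum_gradient_mul_pd gB f hpos, comp_extChartAt_symm_apply]
  change _ * gF.riemann b' y α β γ δ - _ * (gF.metric b' y β γ * gF.metric b' y α δ
    - gF.metric b' y β δ * gF.metric b' y α γ) = _
  ring

/-! ### The Ricci tensor -/

/-- The fibre part of the trace pairs `f⁻¹ g̃^{αδ}` with `-f T_{jk} g̃_{αδ}`, whence `-q T_{jk}`. -/
theorem warped_ricci_base (j k : ι) :
    (warpedProduct gB gF f hf hpos).ricci (b.prod b') (x, y) (Sum.inl j) (Sum.inl k) =
      gB.ricci b x j k - Fintype.card κ * gB.warpT b f x j k := by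
  have hfx := (hpos x).ne'
  simp only [ricci, Fintype.sum_sum_type, warped_inverse_base, warped_inverse_base_fiber,
    warped_inverse_fiber_base, warped_inverse_fiber, warped_riemann_base,
    warped_riemann_fiber_base_base_fiber, zero_mul, Finset.sum_const_zero, add_zero, zero_add,
    ← gF.sum_sum_inverse_mul_metric b' y, sub_eq_add_neg, Finset.sum_mul,
    ← Finset.sum_neg_distrib]
  congr 1
  refine Finset.sum_congr rfl fun α _ => Finset.sum_congr rfl fun δ _ => ?_
  field_simp

theorem warped_ricci_base_fiber (j : ι) (γ : κ) :
    (warpedProduct gB gF f hf hpos).ricci (b.prod b') (x, y) (Sum.inl j) (Sum.inr γ) = 0 := by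
  simp [ricci, warped_inverse_base_fiber,
    warped_inverse_fiber_base, riemann_swap _ _ _ _ _ (Sum.inl _) (Sum.inr _),
    warped_riemann_base_base_base_fiber, warped_riemann_fiber_base_fiber_fiber]

theorem warped_ricci_fiber_base (β : κ) (k : ι) :
    (warpedProduct gB gF f hf hpos).ricci (b.prod b') (x, y) (Sum.inr β) (Sum.inl k) = 0 := by
  simp [ricci, warped_inverse_base_fiber,
    warped_inverse_fiber_base, warped_riemann_base_fiber_base_base,
    warped_riemann_fiber_fiber_base_fiber]

/-- The two parts of `Q` have separate origins: `-f tr T` is the base trace of the mixed block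
(`h1`), and `-(q - 1) f P` is the fibre trace of the Gauss correction (`h2`). -/
theorem warped_ricci_fiber (β γ : κ) :
    (warpedProduct gB gF f hf hpos).ricci (b.prod b') (x, y) (Sum.inr β) (Sum.inr γ) =
      gF.ricci b' y β γ + gB.warpQ b (Fintype.card κ) f x * gF.metric b' y β γ := by
  have hfx := (hpos x).ne'
  have h1 : ∑ a, ∑ d, gB.inverse b x a d * -(f x * gB.warpT b f x a d * gF.metric b' y β γ) =
      -(f x * gB.warpTrT b f x * gF.metric b' y β γ) := by
    simp only [warpTrT, Finset.mul_sum, Finset.sum_mul, ← Finset.sum_neg_distrib]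
    exact Finset.sum_congr rfl fun α _ => Finset.sum_congr rfl fun δ _ => by ring
  have h2 : ∑ α, ∑ δ, (f x)⁻¹ * gF.inverse b' y α δ * (f x * gF.riemann b' y α β γ δ -
      f x ^ 2 * gB.warpP b f x * (gF.metric b' y β γ * gF.metric b' y α δ
        - gF.metric b' y β δ * gF.metric b' y α γ)) =
      gF.ricci b' y β γ - f x * gB.warpP b f x * gF.metric b' y β γ * Fintype.card κ
        + f x * gB.warpP b f x * gF.metric b' y β γ := by
    rw [← gF.sum_sum_inverse_mul_metric b' y]
    -- Only the last `g̃_{βγ}` is expanded, so that every term on the right is a double sum over `α`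
    -- and `δ`.
    nth_rw 3 [← gF.sum_sum_inverse_mul_metric_mul_metric b' y]
    simp only [ricci, Finset.mul_sum, ← Finset.sum_sub_distrib, ← Finset.sum_add_distrib]
    refine Finset.sum_congr rfl fun α _ => Finset.sum_congr rfl fun δ _ => ?_
    field_simp
    ring
  simp only [ricci, Fintype.sum_sum_type, warped_inverse_base, warped_inverse_base_fiber,
    warped_inverse_fiber_base, warped_inverse_fiber,
    riemann_swap _ _ _ _ _ (Sum.inl _) (Sum.inr _), warped_riemann_base_fiber_base_fiber,
    warped_riemann_fiber, zero_mul, Finset.sum_const_zero, add_zero, zero_add, h1, h2]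
  rw [← ricci, warpQ]
  ring

/-! ### The conformal curvature tensor -/

theorem warped_conformalCurvature_base (a c d e : ι) :
    let n : ℝ := (Fintype.card ι : ℝ) + Fintype.card κ
    let s : ℝ := (warpedProduct gB gF f hf hpos).scalar (b.prod b') (x, y)
    (warpedProduct gB gF f hf hpos).conformalCurvature (b.prod b') (x, y)
        (Sum.inl a) (Sum.inl c) (Sum.inl d) (Sum.inl e) =
      gB.riemann b x a c d e -
        (-(s / (2 * (n - 1) * (n - 2))) *
            kulkarniNomizu (gB.metric b x) (gB.metric b x) a c d e
          + 1 / (n - 2) * kulkarniNomizu (gB.metric b x) (gB.ricci b x) a c d e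
          - Fintype.card κ / (n - 2) *
            kulkarniNomizu (gB.metric b x) (gB.warpT b f x) a c d e) := by
  simp only [conformalCurvature, kulkarniNomizu, warped_riemann_base, warped_metric_base,
    warped_ricci_base, Fintype.card_sum, Nat.cast_add]
  ring

/-- The left-hand side of the mixed condition for conformal flatness of a warped product. -/
def mixedCondition (a c : ι) (α β : κ) : ℝ :=
  let n : ℝ := (Fintype.card ι : ℝ) + Fintype.card κ
  let s : ℝ := (warpedProduct gB gF f hf hpos).scalar (b.prod b') (x, y)
  let Q : ℝ := gB.warpQ b (Fintype.card κ) f x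
  (f x * s / ((n - 1) * (n - 2)) - Q / (n - 2)) * gB.metric b x a c * gF.metric b' y α β
    - 1 / (n - 2) * gB.metric b x a c * gF.ricci b' y α β
    - f x / (n - 2) * gB.ricci b x a c * gF.metric b' y α β
    + f x * (Fintype.card κ / (n - 2) - 1) * gB.warpT b f x a c * gF.metric b' y α β

theorem warped_conformalCurvature_base_fiber_base_fiber (a c : ι) (α β : κ) :
    (warpedProduct gB gF f hf hpos).conformalCurvature (b.prod b') (x, y)
        (Sum.inl a) (Sum.inr α) (Sum.inl c) (Sum.inr β) =
      -mixedCondition gB gF f hf hpos b b' x y a c α β := by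
  -- A mixed component of `g ∧ g` is twice a product of metrics up to sign; splitting off the `2`
  -- leaves the same denominator as in `mixedCondition`.
  have hdiv : ∀ s m k : ℝ, s / (2 * m * k) = 1 / 2 * (s / (m * k)) := fun s m k => by ring
  simp only [conformalCurvature, kulkarniNomizu, warped_riemann_base_fiber_base_fiber,
    warped_metric_base, warped_metric_base_fiber, warped_metric_fiber_base, warped_metric_fiber,
    warped_ricci_base, warped_ricci_fiber, warped_ricci_base_fiber, warped_ricci_fiber_base,
    Fintype.card_sum, Nat.cast_add, mixedCondition, hdiv]
  ring

theorem warped_conformalCurvature_fiber_base_base_fiber (a c : ι) (α β : κ) :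
    (warpedProduct gB gF f hf hpos).conformalCurvature (b.prod b') (x, y)
        (Sum.inr α) (Sum.inl a) (Sum.inl c) (Sum.inr β) =
      mixedCondition gB gF f hf hpos b b' x y a c α β := by
  have hdiv : ∀ s m k : ℝ, s / (2 * m * k) = 1 / 2 * (s / (m * k)) := fun s m k => by ring
  simp only [conformalCurvature, kulkarniNomizu, warped_riemann_fiber_base_base_fiber,
    warped_metric_base, warped_metric_base_fiber, warped_metric_fiber_base, warped_metric_fiber,
    warped_ricci_base, warped_ricci_fiber, warped_ricci_base_fiber, warped_ricci_fiber_base,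
    Fintype.card_sum, Nat.cast_add, mixedCondition, hdiv]
  ring

theorem warped_conformalCurvature_fiber (α β γ δ : κ) :
    let n : ℝ := (Fintype.card ι : ℝ) + Fintype.card κ
    let s : ℝ := (warpedProduct gB gF f hf hpos).scalar (b.prod b') (x, y)
    let Q : ℝ := gB.warpQ b (Fintype.card κ) f x
    (warpedProduct gB gF f hf hpos).conformalCurvature (b.prod b') (x, y)
        (Sum.inr α) (Sum.inr β) (Sum.inr γ) (Sum.inr δ) =
      f x * (gF.riemann b' y α β γ δ -
        ((-(f x * s / (2 * (n - 1) * (n - 2))) + Q / (n - 2) + f x * gB.warpP b f x / 2) *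
            kulkarniNomizu (gF.metric b' y) (gF.metric b' y) α β γ δ
          + 1 / (n - 2) * kulkarniNomizu (gF.metric b' y) (gF.ricci b' y) α β γ δ)) := by
  simp only [conformalCurvature, kulkarniNomizu, warped_riemann_fiber, warped_metric_fiber,
    warped_ricci_fiber, Fintype.card_sum, Nat.cast_add]
  ring

/-- The conformal curvature of a warped product vanishes at a point as soon as the four families
of its components that do not vanish identically do. -/
theorem warped_conformalCurvature_eq_zero
    (hbase : ∀ a c d e, (warpedProduct gB gF f hf hpos).conformalCurvature (b.prod b') (x, y)
      (Sum.inl a) (Sum.inl c) (Sum.inl d) (Sum.inl e) = 0)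
    (hmixed : ∀ a c α β, mixedCondition gB gF f hf hpos b b' x y a c α β = 0)
    (hfiber : ∀ α β γ δ, (warpedProduct gB gF f hf hpos).conformalCurvature (b.prod b') (x, y)
      (Sum.inr α) (Sum.inr β) (Sum.inr γ) (Sum.inr δ) = 0) (h i j k : ι ⊕ κ) :
    (warpedProduct gB gF f hf hpos).conformalCurvature (b.prod b') (x, y) h i j k = 0 := by
  -- Antisymmetry in the last pair lets base-then-fibre stand for both mixed orders. Outside the
  -- blocks treated by `hbase`, `hmixed` and `hfiber`, every term of `g ∧ S` and `g ∧ g` has a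
  -- factor with one base and one fibre index.
  have hlr : ∀ h i (j : ι) (k : κ), (warpedProduct gB gF f hf hpos).conformalCurvature
      (b.prod b') (x, y) h i (Sum.inl j) (Sum.inr k) = 0 := by
    rintro (h | h) (i | i) j k
    · simp [conformalCurvature, kulkarniNomizu, warped_riemann_base_base_base_fiber,
        warped_metric_base_fiber, warped_ricci_base_fiber]
    · rw [warped_conformalCurvature_base_fiber_base_fiber, hmixed, neg_zero]
    · rw [warped_conformalCurvature_fiber_base_base_fiber, hmixed]
    · simp [conformalCurvature, kulkarniNomizu, warped_riemann_fiber_fiber_base_fiber,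
        warped_metric_fiber_base, warped_ricci_fiber_base]
  rcases j with j | j <;> rcases k with k | k
  · rcases h with h | h <;> rcases i with i | i
    · exact hbase h i j k
    · simp [conformalCurvature, kulkarniNomizu, warped_riemann_base_fiber_base_base,
        warped_metric_fiber_base, warped_ricci_fiber_base]
    · simp [conformalCurvature, kulkarniNomizu, warped_riemann_fiber_base_base_base,
        warped_metric_fiber_base, warped_ricci_fiber_base]
    · simp [conformalCurvature, kulkarniNomizu, warped_riemann_fiber_fiber_base_base,
        warped_metric_fiber_base, warped_ricci_fiber_base]
  · exact hlr h i j k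
  · rw [conformalCurvature_swap, hlr h i k j, neg_zero]
  · rcases h with h | h <;> rcases i with i | i
    · simp [conformalCurvature, kulkarniNomizu, warped_riemann_base_base_fiber_fiber,
        warped_metric_base_fiber, warped_ricci_base_fiber]
    · simp [conformalCurvature, kulkarniNomizu, warped_riemann_base_fiber_fiber_fiber,
        warped_metric_base_fiber, warped_ricci_base_fiber]
    · simp [conformalCurvature, kulkarniNomizu, warped_riemann_fiber_base_fiber_fiber,
        warped_metric_base_fiber, warped_ricci_base_fiber]
    · exact hfiber h i j k

end

end SemiRiemannianMetric

end

theorem corollary5p4 {p q : ℕ} (hp : 1 ≤ p) (hq : 1 ≤ q) (hn : 3 ≤ p + q)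
    {B : Type*} [TopologicalSpace B] [ChartedSpace (EuclideanSpace ℝ (Fin p)) B]
    [IsManifold (𝓡 p) ∞ B]
    {F : Type*} [TopologicalSpace F] [ChartedSpace (EuclideanSpace ℝ (Fin q)) F]
    [IsManifold (𝓡 q) ∞ F]
    (gB : SemiRiemannianMetric (𝓡 p) B) (gF : SemiRiemannianMetric (𝓡 q) F)
    (f : B → ℝ) (hf : ContMDiff (𝓡 p) 𝓘(ℝ, ℝ) ∞ f) (hpos : ∀ x, 0 < f x)
    (hnonflat : ¬ (warpedProduct gB gF f hf hpos).IsFlat (prodBasis p q)) :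
    (warpedProduct gB gF f hf hpos).IsConformallyFlat (prodBasis p q) ↔
      ∀ (x : B) (y : F),
        -- the data of the base and the fiber at `x` and `y`
        let n : ℝ := (p : ℝ) + q
        let bB := stdBasis p
        let bF := stdBasis q
        let κ : ℝ := (warpedProduct gB gF f hf hpos).scalar (prodBasis p q) (x, y)
        let T : Fin p → Fin p → ℝ := gB.warpT bB f x
        let P : ℝ := gB.warpP bB f x
        let Q : ℝ := gB.warpQ bB q f x
        -- the base condition
        (∀ a b c d : Fin p,
          gB.riemann bB x a b c d =
            -(κ / (2 * (n - 1) * (n - 2))) *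
                kulkarniNomizu (gB.metric bB x) (gB.metric bB x) a b c d
              + 1 / (n - 2) * kulkarniNomizu (gB.metric bB x) (gB.ricci bB x) a b c d
              - q / (n - 2) * kulkarniNomizu (gB.metric bB x) T a b c d) ∧
        -- the mixed condition
        (∀ (a b : Fin p) (α β : Fin q),
          (f x * κ / ((n - 1) * (n - 2)) - Q / (n - 2)) * gB.metric bB x a b * gF.metric bF y α β
              - 1 / (n - 2) * gB.metric bB x a b * gF.ricci bF y α β
              - f x / (n - 2) * gB.ricci bB x a b * gF.metric bF y α β
              + f x * (q / (n - 2) - 1) * T a b * gF.metric bF y α β = 0) ∧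
        -- the fiber condition
        (∀ α β γ δ : Fin q,
          gF.riemann bF y α β γ δ =
            (-(f x * κ / (2 * (n - 1) * (n - 2))) + Q / (n - 2) + f x * P / 2) *
                kulkarniNomizu (gF.metric bF y) (gF.metric bF y) α β γ δ
              + 1 / (n - 2) *
                kulkarniNomizu (gF.metric bF y) (gF.ricci bF y) α β γ δ) := by
  
  constructor
  · intro hC x y
    refine ⟨fun a b c d => ?_, fun a b α β => ?_, fun α β γ δ => ?_⟩
    · have h := SemiRiemannianMetric.warped_conformalCurvature_base gB gF f hf hpos (stdBasis p)
        (stdBasis q) x y a b c d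
      simp only [Fintype.card_fin] at h
      exact sub_eq_zero.1 (h.symm.trans (hC (x, y) _ _ _ _))
    · have h := SemiRiemannianMetric.warped_conformalCurvature_fiber_base_base_fiber gB gF f hf hpos
        (stdBasis p) (stdBasis q) x y a b α β
      simp only [SemiRiemannianMetric.mixedCondition, Fintype.card_fin] at h
      exact h.symm.trans (hC (x, y) _ _ _ _)
    · have h := SemiRiemannianMetric.warped_conformalCurvature_fiber gB gF f hf hpos (stdBasis p)
        (stdBasis q) x y α β γ δ
      simp only [Fintype.card_fin] at h
      -- The fibre block of `C` is `f` times the difference of the two sides, and `f` is positive.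
      exact sub_eq_zero.1 ((mul_eq_zero.1 (h.symm.trans (hC (x, y) _ _ _ _))).resolve_left
        (hpos x).ne')
  · rintro hC ⟨x, y⟩ h i j k
    obtain ⟨h1, h2, h3⟩ := hC x y
    refine SemiRiemannianMetric.warped_conformalCurvature_eq_zero gB gF f hf hpos (stdBasis p)
      (stdBasis q) x y (fun a b c d => ?_) (fun a b α β => ?_) (fun α β γ δ => ?_) h i j k
    · rw [SemiRiemannianMetric.warped_conformalCurvature_base]
      simp only [Fintype.card_fin]
      exact sub_eq_zero.2 (h1 a b c d)
    · simp only [SemiRiemannianMetric.mixedCondition, Fintype.card_fin]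
      exact h2 a b α β
    · rw [SemiRiemannianMetric.warped_conformalCurvature_fiber]
      simp only [Fintype.card_fin]
      exact mul_eq_zero_of_right _ (sub_eq_zero.2 (h3 α β γ δ))
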